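/- Let $k\ge 2$ be an integer, and for $1\le i\le k$ put $c_k=1-\frac{3(2k-1)^2}{2k+1}$, $h_{i,k}=\frac{(2(k-i)+1)^2-(2k-1)^2}{8(2k+1)}$ and $$\mathrm{ch}_{i,k}(z)=q^{h_{i,k}-c_k/24}\prod_{\substack{n\ge 1\\ n\not\equiv 0,\pm i\ (\mathrm{mod}\ 2k+1)}}\frac1{1-q^n},\qquad q^r=e^{2\pi i rz},\ z\in\mathbb H$$ (the characters of the $(2,2k+1)$ Virasoro minimal model). Write $f'=\frac1{2\pi i}\frac{df}{dz}$, and let $\mathcal W_k$ and $\mathcal W_k'$ be the determinants $\det\big(\mathrm{ch}_{j,k}^{(r)}\big)_{0\le r\le k-1,\,1\le j\le k}$ and $\det\big(\mathrm{ch}_{j,k}^{(r)}\big)_{1\le r\le k,\,1\le j\le k}$, each multiplied by the constant that makes the leading coefficient of its $q$-expansion equal to $1$ (with $\mathcal W_k'=0$ if the second determinant vanishes identically). Then: 1. The first determinant has a $q$-expansion with nonzero leading coefficient, $\mathcal W_k$ has no zeros on $\mathbb H$, and the second determinant is either identically zero or has a $q$-expansion with nonzero leading coefficient. So $\mathcal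 F_k:=\mathcal W_k'/\mathcal W_k$ is a well-defined function on $\mathbb H$. 2. $\mathcal F_k$ is a holomorphic modular form of weight $2k$ on $\mathrm{SL}_2(\mathbb Z)$ (possibly zero). 3. There is exactly one $k$-tuple of functions $P_0,\dots,P_{k-1}$ on $\mathbb H$ such that $\mathrm{ch}_{1,k},\dots,\mathrm{ch}_{k,k}$ all satisfy $$y^{(k)}+\sum_{i=0}^{k-1}P_i\,y^{(i)}=0 .$$ The characters form a fundamental system of this equation, that is, a basis of the space of its holomorphic solutions on $\mathbb H$. The equation is modular: $P_i\in\mathbb Q[E_2,E_4,E_6]$ for all $i$, and on holomorphic functions the left-hand side equals $\Theta^k y+\sum_{i=0}^{k-1}Q_i\,\Theta^i y$, where $Q_i$ is a holomorphic modular form of weight $2k-2i$ on $\mathrm{SL}_2(\mathbb Z)$, $\Theta^i=\Theta_{2i-2}\circ\cdots\circ\Theta_2\circ\Theta_0$, and $\Theta_w y=y'-\frac w{12}E_2\,y$. Moreover $P_0=\lambda_k\,\mathcal F_k$ for some nonzero constant $\lambda_k\in\mathbb C$. -/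

import Mathlib

open scoped Derivative MatrixGroups Manifold

noncomputable section

namespace AndrewsGordon

open Complex

/-- The central charge `c_k = 1 - 3 (2k-1)² / (2k+1)` of the `(2, 2k+1)` minimal model. -/
def centralCharge (k : ℕ) : ℚ := 1 - 3 * (2 * (k : ℚ) - 1) ^ 2 / (2 * (k : ℚ) + 1)

/-- The weight `h_{i,k} = ((2(k-i)+1)² - (2k-1)²) / (8(2k+1))`. -/
def weight (k i : ℕ) : ℚ :=
  ((2 * ((k : ℚ) - (i : ℚ)) + 1) ^ 2 - (2 * (k : ℚ) - 1) ^ 2) / (8 * (2 * (k : ℚ) + 1))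

/-- `q^r = exp(2 π i r z)` for a rational exponent `r`. -/
def qPow (r : ℚ) (z : UpperHalfPlane) : ℂ := cexp (2 * Real.pi * I * (r : ℂ) * (z : ℂ))

/-- The character `ch_{i,k}`: the Andrews-Gordon product over the `n ≥ 1` with
`n ≢ 0, ± i (mod 2k+1)` of `1 / (1 - q^n)`, multiplied by `q^(h_{i,k} - c_k/24)`. -/
def character (k i : ℕ) (z : UpperHalfPlane) : ℂ :=
  qPow (weight k i - centralCharge k / 24) z *
    ∏' n : ℕ+, if ((n : ℕ) : ZMod (2 * k + 1)) ≠ 0 ∧ ((n : ℕ) : ZMod (2 * k + 1)) ≠ (i : ZMod (2 * k + 1)) ∧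
        ((n : ℕ) : ZMod (2 * k + 1)) ≠ -(i : ZMod (2 * k + 1))
      then (1 - qPow ((n : ℕ) : ℚ) z)⁻¹ else 1

/-- The family `ch_{1,k}, …, ch_{k,k}`. -/
def characters (k : ℕ) (j : Fin k) : UpperHalfPlane → ℂ := character k (j.val + 1)

/-- `f` has an expansion `f(z) = ∑_{n ≥ 0} a_n q^(r+n)` on the upper half-plane, with `r` rational and
leading coefficient `a_0 = c ≠ 0`. -/
def HasLeadingCoeff (f : UpperHalfPlane → ℂ) (c : ℂ) : Prop :=
  c ≠ 0 ∧ ∃ (r : ℚ) (a : ℕ → ℂ), a 0 = c ∧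
    ∀ z : UpperHalfPlane, HasSum (fun n : ℕ => a n * qPow (r + (n : ℚ)) z) (f z)

open Classical in
/-- The multiple of `f` whose `q`-expansion has leading coefficient `1`
(`0` if `f` has no leading coefficient, in particular if `f = 0`). -/
def normalize (f : UpperHalfPlane → ℂ) : UpperHalfPlane → ℂ :=
  if h : ∃ c, HasLeadingCoeff f c then (h.choose)⁻¹ • f else 0

/-- The determinant with rows `f^(m), f^(m+1), …, f^(m+k-1)`, where `f' = (2 π i)⁻¹ df/dz`. It is the
Wronskian for `m = 0`. -/
def wronskian {k : ℕ} (m : ℕ) (f : Fin k → UpperHalfPlane → ℂ) (z : UpperHalfPlane) : ℂ :=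
  (Matrix.of fun r c : Fin k => (D^[r.val + m]) (f c) z).det

/-- The normalized Wronskian `𝒲_k` of the characters. -/
def W (k : ℕ) : UpperHalfPlane → ℂ := normalize (wronskian 0 (characters k))

/-- The normalized Wronskian `𝒲'_k` of the derivatives of the characters. -/
def W' (k : ℕ) : UpperHalfPlane → ℂ := normalize (wronskian 1 (characters k))

/-- The quotient `𝓕_k = 𝒲'_k / 𝒲_k`. -/
def F (k : ℕ) (z : UpperHalfPlane) : ℂ := W' k z / W k z

/-- The monic operator `y ↦ y^(k) + ∑_{i < k} P_i y^(i)`, where `y' = (2 π i)⁻¹ dy/dz`. -/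
def monicOp {k : ℕ} (P : Fin k → UpperHalfPlane → ℂ) (y : UpperHalfPlane → ℂ) : UpperHalfPlane → ℂ :=
  (D^[k]) y + ∑ i : Fin k, P i * (D^[i.val]) y

/-- The iterated Serre derivative `Θ^i = Θ_{2i-2} ∘ ⋯ ∘ Θ_2 ∘ Θ_0`, where
`Θ_w = (2 π i)⁻¹ d/dz - (w/12) E₂`. -/
def serreIter : ℕ → (UpperHalfPlane → ℂ) → UpperHalfPlane → ℂ
  | 0, y => y
  | i + 1, y => Derivative.serreDerivative (2 * (i : ℂ)) (serreIter i y)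

/-- The operator `y^(k) + ∑ P_i y^(i)` is modular with rational coefficients: the `P_i` lie in
`ℚ[E₂, E₄, E₆]`, and on holomorphic functions it can be rewritten as `Θ^k y + ∑ Q_i Θ^i y` with
holomorphic modular forms `Q_i` of weight `2k - 2i` on `SL₂(ℤ)`. -/
def IsModularOp {k : ℕ} (P : Fin k → UpperHalfPlane → ℂ) : Prop :=
  (∀ i, P i ∈ Algebra.adjoin ℚ
    ({EisensteinSeries.E2, ⇑ModularForm.E₄, ⇑ModularForm.E₆} : Set (UpperHalfPlane → ℂ))) ∧
  ∃ Q : (i : Fin k) → ModularForm 𝒮ℒ (2 * (k : ℤ) - 2 * (i.val : ℤ)),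
    ∀ y : UpperHalfPlane → ℂ, MDiff y →
      monicOp P y = serreIter k y + ∑ i : Fin k, ⇑(Q i) * serreIter i.val y

/-- `f` is a fundamental system of `y^(k) + ∑ P_i y^(i) = 0`: a basis of the space of all holomorphic
solutions on the upper half-plane. -/
def IsFundamentalSystem {k : ℕ} (P : Fin k → UpperHalfPlane → ℂ)
    (f : Fin k → UpperHalfPlane → ℂ) : Prop :=
  LinearIndependent ℂ f ∧
    ∀ y : UpperHalfPlane → ℂ,
      y ∈ Submodule.span ℂ (Set.range f) ↔ (MDiff y ∧ monicOp P y = 0)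

end AndrewsGordon

end

/-!
The argument compares the Wronskian of the characters with the discriminant `Δ` and then reads the
coefficients of the differential equation off Cramer's rule.

By the Jacobi triple product (`tendsto_prod_triple`) every character is a theta series of modulus
`2k+1` divided by `η` (`character_mul_eta`), so Jacobi's inversion formula shows that the span of the
characters is stable under `z ↦ -1/z` (`exists_characters_S_smul`). Each character also has a
`q`-expansion with rational coefficients, leading coefficient `1` and exponent
`thetaExponent k i - 1/24`. These exponents are distinct, so the Wronskian has a leading coefficient,
a Vandermonde determinant, and they add up to `k(k-1)/12` (`sum_thetaExponent`).

The Wronskian may be computed with iterated Serre derivatives (`det_serreIter`), which commute with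
the action of `SL₂(ℤ)`. The matrix by which `z ↦ -1/z` acts on the characters has
determinant `±1`, so the `12`-th power of the Wronskian is a modular form of weight `12k(k-1)`, whose
order at infinity is `k(k-1)`. Divided by `Δ^(k(k-1))` it becomes a form of weight `0`, a constant,
and therefore the Wronskian has no zeros (`wronskian_zero_ne_zero`).

The characters then satisfy a unique monic equation, and its coefficients `Q_i` with respect to the
`Θ^i` are quotients of determinants by the Wronskian (`cramerCoeff`). Their behaviour under
`z ↦ -1/z` follows from the uniqueness of the solution of the linear system
(`cramerCoeff_slash_S`), and their expansions in nonnegative integral powers of `q` with rational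
coefficients make them modular forms in `ℚ[E₄, E₆]` (`mem_adjoin_of_hasQExp`). Rewriting `Θ` through
`D` stays in `ℚ[E₂, E₄, E₆]`, since this ring is stable under `D` (`mdiff_and_deriv_mem`). Finally
`P₀ = Q₀`, and replacing the last row of the second determinant by means of the equation turns it
into `± P₀` times the first (`wronskian_one`).
-/

open scoped Derivative MatrixGroups Manifold

noncomputable section

namespace AndrewsGordon

open Complex
open UpperHalfPlane hiding I
open scoped Topology

/-! ### Power series on the unit disc -/

/-- The power series `c` converges to `F` on the open unit disc. -/
def DiscSum (c : PowerSeries ℂ) (F : ℂ → ℂ) : Prop :=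
  ∀ q : ℂ, ‖q‖ < 1 → HasSum (fun n : ℕ => c.coeff n * q ^ n) (F q)

namespace DiscSum

variable {c d : PowerSeries ℂ} {F G : ℂ → ℂ}

theorem hasFPowerSeriesOnBall (h : DiscSum c F) :
    HasFPowerSeriesOnBall F (.ofScalars ℂ fun n => c.coeff n) 0 1 := by
  constructor
  · refine le_of_forall_lt_imp_le_of_dense fun r hr ↦ ?_
    lift r to NNReal using hr.ne_top
    apply FormalMultilinearSeries.le_radius_of_summable
    have := (h (r : ℝ) (by simpa using hr)).summable.norm
    simpa [smul_eq_mul, norm_mul, mul_comm, mul_left_comm, mul_assoc] using this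
  · simp
  · intro y hy
    rw [← ENNReal.coe_one, Metric.eball_coe, NNReal.coe_one, mem_ball_zero_iff] at hy
    simpa [mul_comm] using h y hy

theorem differentiableOn (h : DiscSum c F) : DifferentiableOn ℂ F (Metric.ball 0 1) := by
  have := h.hasFPowerSeriesOnBall.differentiableOn
  rwa [← ENNReal.coe_one, Metric.eball_coe, NNReal.coe_one] at this

theorem of_differentiableOn (h : DifferentiableOn ℂ F (Metric.ball 0 1)) :
    DiscSum (PowerSeries.mk fun n => (n.factorial : ℂ)⁻¹ * iteratedDeriv n F 0) F := by
  intro q hq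
  have := hasSum_taylorSeries_on_ball h (by simpa using hq : q ∈ Metric.ball 0 1)
  refine this.congr_fun fun n => ?_
  simp only [PowerSeries.coeff_mk, sub_zero, smul_eq_mul]
  ring

theorem eq_of_eqOn (h : DiscSum c F) (h' : DiscSum d F) : c = d := by
  have := h.hasFPowerSeriesOnBall.hasFPowerSeriesAt.eq_formalMultilinearSeries
    h'.hasFPowerSeriesOnBall.hasFPowerSeriesAt
  ext n
  have h2 := congrArg (fun p => FormalMultilinearSeries.coeff p n) this
  simpa [FormalMultilinearSeries.coeff_ofScalars] using h2

theorem mul (h : DiscSum c F) (h' : DiscSum d G) : DiscSum (c * d) (F * G) := by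
  intro q hq
  have h1 := h q hq
  have h2 := h' q hq
  have e : (fun n : ℕ => (c * d).coeff n * q ^ n) = fun n => ∑ kl ∈ Finset.HasAntidiagonal.antidiagonal n,
      (c.coeff kl.1 * q ^ kl.1) * (d.coeff kl.2 * q ^ kl.2) := by
    funext n
    rw [PowerSeries.coeff_mul, Finset.sum_mul]
    refine Finset.sum_congr rfl fun x hx => ?_
    rw [← Finset.HasAntidiagonal.mem_antidiagonal.mp hx]; ring
  rw [e, Pi.mul_apply, ← h1.tsum_eq, ← h2.tsum_eq,
    tsum_mul_tsum_eq_tsum_sum_antidiagonal_of_summable_norm h1.summable.norm h2.summable.norm]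
  exact (summable_norm_sum_mul_antidiagonal_of_summable_norm h1.summable.norm
    h2.summable.norm).of_norm.hasSum

theorem deriv (h : DiscSum c F) :
    DiscSum (PowerSeries.mk fun n => (n + 1 : ℂ) * c.coeff (n + 1)) (deriv F) := by
  have h1 := of_differentiableOn h.differentiableOn
  have h2 := of_differentiableOn (h.differentiableOn.deriv Metric.isOpen_ball)
  rw [h.eq_of_eqOn h1]
  convert h2 using 3 with n
  rw [PowerSeries.coeff_mk, iteratedDeriv_succ', Nat.factorial_succ]
  push_cast
  have := Nat.cast_add_one_ne_zero (R := ℂ) n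
  field_simp

end DiscSum

/-! ### Rational `q`-expansions on the upper half-plane -/

theorem qPow_add (r s : ℚ) (z : ℍ) : qPow (r + s) z = qPow r z * qPow s z := by
  simp only [qPow, ← Complex.exp_add]; congr 1; push_cast; ring

@[simp] theorem qPow_zero (z : ℍ) : qPow 0 z = 1 := by simp [qPow]

theorem qPow_ne_zero (r : ℚ) (z : ℍ) : qPow r z ≠ 0 := Complex.exp_ne_zero _

theorem qPow_neg (r : ℚ) (z : ℍ) : qPow (-r) z = (qPow r z)⁻¹ := by
  refine eq_inv_of_mul_eq_one_left ?_
  rw [← qPow_add, neg_add_cancel, qPow_zero]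

theorem qPow_nat_mul (r : ℚ) (n : ℕ) (z : ℍ) : qPow (n * r) z = qPow r z ^ n := by
  simp only [qPow, ← Complex.exp_nat_mul]; congr 1; push_cast; ring

theorem qPow_natCast (n : ℕ) (z : ℍ) : qPow n z = qPow 1 z ^ n := by
  simpa using qPow_nat_mul 1 n z

theorem qPow_one (z : ℍ) : qPow 1 z = Function.Periodic.qParam 1 z := by
  simp [qPow, Function.Periodic.qParam]

theorem norm_qPow_one_lt (z : ℍ) : ‖qPow 1 z‖ < 1 := by
  rw [qPow_one]; exact mod_cast UpperHalfPlane.norm_qParam_lt_one 1 z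

theorem exists_qPow_one_eq {q : ℂ} (hq : ‖q‖ < 1) (h0 : q ≠ 0) : ∃ z : ℍ, qPow 1 z = q :=
  ⟨⟨_, Function.Periodic.im_invQParam_pos_of_norm_lt_one one_pos hq h0⟩, by
    rw [qPow_one]; exact Function.Periodic.qParam_right_inv one_ne_zero h0⟩

/-- `f(z) = ∑ₙ pₙ q^(r+n)` on the upper half-plane, for a power series `p` with rational
coefficients. -/
def HasQExp (r : ℚ) (p : PowerSeries ℚ) (f : ℍ → ℂ) : Prop :=
  ∀ z : ℍ, HasSum (fun n : ℕ => ((p.coeff n : ℚ) : ℂ) * qPow (r + n) z) (f z)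

/-- The complex power series attached to a rational one. -/
abbrev toC (p : PowerSeries ℚ) : PowerSeries ℂ := p.map (algebraMap ℚ ℂ)

/-- A `q`-expansion is `q^r` times a holomorphic function of `q` on the unit disc. -/
theorem hasQExp_iff_exists {r : ℚ} {p : PowerSeries ℚ} {f : ℍ → ℂ} :
    HasQExp r p f ↔ ∃ F, DiscSum (toC p) F ∧ ∀ z, f z = qPow r z * F (qPow 1 z) := by
  constructor
  · intro h
    have key : ∀ z, HasSum (fun n : ℕ => (toC p).coeff n * qPow 1 z ^ n) (qPow (-r) z * f z) := by
      intro z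
      refine ((h z).mul_left (qPow (-r) z)).congr_fun ?_
      intro n
      have h1 := qPow_ne_zero r z
      rw [qPow_add, qPow_natCast, qPow_neg, PowerSeries.coeff_map]
      simp only [eq_ratCast]
      field_simp
    refine ⟨fun q => ∑' n, (toC p).coeff n * q ^ n, ?_, ?_⟩
    · intro q hq
      refine Summable.hasSum ?_
      rcases eq_or_ne q 0 with rfl | h0
      · exact summable_of_ne_finset_zero (s := {0}) fun n hn => by
          simp at hn; simp [hn]
      · obtain ⟨z, rfl⟩ := exists_qPow_one_eq hq h0
        exact (key z).summable
    · intro z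
      simp only
      rw [(key z).tsum_eq, ← mul_assoc, ← qPow_add, add_neg_cancel, qPow_zero, one_mul]
  · rintro ⟨F, hF, hf⟩ z
    rw [hf]
    refine ((hF _ (norm_qPow_one_lt z)).mul_left (qPow r z)).congr_fun ?_
    intro n
    rw [qPow_add, qPow_natCast, PowerSeries.coeff_map]
    simp only [eq_ratCast]
    ring

namespace HasQExp

variable {r s : ℚ} {p u : PowerSeries ℚ} {f g : ℍ → ℂ}

theorem mul (hf : HasQExp r p f) (hg : HasQExp s u g) : HasQExp (r + s) (p * u) (f * g) := by
  obtain ⟨F, hF, hf⟩ := hasQExp_iff_exists.mp hf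
  obtain ⟨G, hG, hg⟩ := hasQExp_iff_exists.mp hg
  refine hasQExp_iff_exists.mpr ⟨F * G, ?_, fun z => ?_⟩
  · simpa only [toC, map_mul] using hF.mul hG
  · simp only [Pi.mul_apply, hf z, hg z, qPow_add]; ring

theorem add (hf : HasQExp r p f) (hg : HasQExp r u g) : HasQExp r (p + u) (f + g) := fun z =>
  ((hf z).add (hg z)).congr_fun fun n => by rw [map_add]; push_cast; ring

theorem smul (c : ℚ) (hf : HasQExp r p f) : HasQExp r (c • p) ((c : ℂ) • f) := fun z =>
  ((hf z).mul_left (c : ℂ)).congr_fun fun n => by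
    rw [PowerSeries.coeff_smul]; simp; ring

protected theorem zero : HasQExp r 0 0 := fun z => by simp

theorem sub (hf : HasQExp r p f) (hg : HasQExp r u g) : HasQExp r (p - u) (f - g) := by
  have := hf.add (hg.smul (-1))
  simpa [sub_eq_add_neg] using this

theorem sum {ι : Type*} (t : Finset ι) {p : ι → PowerSeries ℚ} {f : ι → ℍ → ℂ}
    (h : ∀ i ∈ t, HasQExp r (p i) (f i)) : HasQExp r (∑ i ∈ t, p i) (∑ i ∈ t, f i) := by
  classical
  induction t using Finset.induction_on with
  | empty => simpa using HasQExp.zero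
  | insert a t ha ih =>
    rw [Finset.sum_insert ha, Finset.sum_insert ha]
    exact (h a (by simp)).add (ih fun i hi => h i (by simp [hi]))

protected theorem one : HasQExp 0 1 1 := by
  refine hasQExp_iff_exists.mpr ⟨1, fun q hq => ?_, fun z => by simp⟩
  have := hasSum_single (f := fun n : ℕ => (toC 1).coeff n * q ^ n) 0
    (fun n hn => by simp [PowerSeries.coeff_one, hn])
  simpa using this

theorem prod {ι : Type*} (t : Finset ι) {r : ι → ℚ} {p : ι → PowerSeries ℚ} {f : ι → ℍ → ℂ}
    (h : ∀ i ∈ t, HasQExp (r i) (p i) (f i)) :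
    HasQExp (∑ i ∈ t, r i) (∏ i ∈ t, p i) (∏ i ∈ t, f i) := by
  classical
  induction t using Finset.induction_on with
  | empty => simpa using HasQExp.one
  | insert a t ha ih =>
    rw [Finset.sum_insert ha, Finset.prod_insert ha, Finset.prod_insert ha]
    exact (h a (by simp)).mul (ih fun i hi => h i (by simp [hi]))

theorem pow (hf : HasQExp r p f) (n : ℕ) : HasQExp (n * r) (p ^ n) (f ^ n) := by
  simpa using prod (Finset.range n) (fun _ _ => hf)

theorem det {n : ℕ} {r : Fin n → ℚ} {p : Matrix (Fin n) (Fin n) (PowerSeries ℚ)}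
    {f : Fin n → Fin n → ℍ → ℂ} (h : ∀ i j, HasQExp (r j) (p i j) (f i j)) :
    HasQExp (∑ j, r j) p.det (fun z => (Matrix.of fun i j => f i j z).det) := by
  have e : (fun z => (Matrix.of fun i j => f i j z).det) =
      ∑ σ : Equiv.Perm (Fin n), (((Equiv.Perm.sign σ : ℤ) : ℚ) : ℂ) • ∏ i, f (σ i) i := by
    funext z
    rw [Matrix.det_apply, Finset.sum_apply]
    refine Finset.sum_congr rfl fun σ _ => ?_
    simp [Units.smul_def]
  rw [e, Matrix.det_apply]
  refine sum _ fun σ _ => ?_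
  have := (prod Finset.univ (fun i _ => h (σ i) i)).smul ((Equiv.Perm.sign σ : ℤ) : ℚ)
  convert this using 1
  rw [Units.smul_def, Int.cast_smul_eq_zsmul]

/-- A `q`-expansion may be divided by one with nonzero constant term and nonvanishing sum. -/
theorem div (hf : HasQExp r p f) (hg : HasQExp s u g) (hu : u.constantCoeff ≠ 0)
    (hg0 : ∀ z, g z ≠ 0) : HasQExp (r - s) (p * u⁻¹) (f / g) := by
  obtain ⟨F, hF, hf⟩ := hasQExp_iff_exists.mp hf
  obtain ⟨G, hG, hg⟩ := hasQExp_iff_exists.mp hg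
  have hG0 : ∀ q ∈ Metric.ball (0 : ℂ) 1, G q ≠ 0 := by
    intro q hq
    rw [mem_ball_zero_iff] at hq
    rcases eq_or_ne q 0 with rfl | h0
    · have h1 := hG 0 (by simp)
      have h2 := hasSum_single (f := fun n : ℕ => (toC u).coeff n * (0 : ℂ) ^ n) 0
        (fun n hn => by simp [hn])
      rw [h1.unique h2]
      simpa using hu
    · obtain ⟨z, rfl⟩ := exists_qPow_one_eq hq h0
      intro h
      exact hg0 z (by rw [hg, h, mul_zero])
  have hH := DiscSum.of_differentiableOn (hF.differentiableOn.div hG.differentiableOn hG0)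
  set c := PowerSeries.mk fun n => (n.factorial : ℂ)⁻¹ * iteratedDeriv n (F / G) 0
  have hc : c * toC u = toC p := by
    refine (hH.mul hG).eq_of_eqOn (F := F / G * G) ?_
    intro q hq
    simp only [Pi.mul_apply, Pi.div_apply]
    rw [div_mul_cancel₀ _ (hG0 q (by simpa using hq))]
    exact hF q hq
  have hc2 : c = toC (p * u⁻¹) := by
    have h1 : toC u * toC u⁻¹ = 1 := by
      rw [← map_mul, PowerSeries.mul_inv_cancel u hu, map_one]
    rw [toC, map_mul, ← toC, ← toC, ← hc, mul_assoc, h1, mul_one]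
  refine hasQExp_iff_exists.mpr ⟨F / G, hc2 ▸ hH, fun z => ?_⟩
  have h1 := qPow_ne_zero s z
  simp only [Pi.div_apply, hf z, hg z, sub_eq_add_neg, qPow_add, qPow_neg]
  field_simp

theorem exists_hasDerivAt (hf : HasQExp r p f) : ∀ z : ℍ, ∃ d : ℂ,
    HasDerivAt (f ∘ ofComplex) (2 * Real.pi * I * d) z ∧
    HasSum (fun n : ℕ => (((r + n) * p.coeff n : ℚ) : ℂ) * qPow (r + n) z) d := by
  obtain ⟨F, hF, hf⟩ := hasQExp_iff_exists.mp hf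
  intro z
  set q := qPow 1 z with hq
  have hqn := norm_qPow_one_lt z
  have hFd : HasDerivAt F (deriv F q) q :=
    (hF.differentiableOn.differentiableAt
      (Metric.isOpen_ball.mem_nhds (by simpa using hqn))).hasDerivAt
  have hexp (c : ℂ) : HasDerivAt (fun w : ℂ => cexp (2 * Real.pi * I * c * w))
      (cexp (2 * Real.pi * I * c * z) * (2 * Real.pi * I * c)) z := by
    simpa using ((hasDerivAt_id (z : ℂ)).const_mul (2 * Real.pi * I * c)).cexp
  refine ⟨r * (qPow r z * F q) + qPow r z * (q * deriv F q), ?_, ?_⟩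
  · have h1 : f ∘ ofComplex =ᶠ[𝓝 (z : ℂ)] fun w =>
        cexp (2 * Real.pi * I * r * w) * F (cexp (2 * Real.pi * I * ((1 : ℚ) : ℂ) * w)) := by
      filter_upwards [isOpen_upperHalfPlaneSet.mem_nhds z.2] with w hw
      simp [Function.comp_apply, ofComplex_apply_of_im_pos hw, hf, qPow]
    have hFd' : HasDerivAt F (deriv F q) (cexp (2 * Real.pi * I * ((1 : ℚ) : ℂ) * z)) := hFd
    refine HasDerivAt.congr_of_eventuallyEq ?_ h1
    refine ((hexp r).mul (hFd'.comp (z : ℂ) (hexp ((1 : ℚ) : ℂ)))).congr_deriv ?_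
    simp only [hq, qPow, Function.comp_apply]
    push_cast
    ring
  · have h1 := hF q hqn
    have h2 := (hF.deriv q hqn).mul_left q
    have h3 : HasSum (fun n : ℕ => (n : ℂ) * (toC p).coeff n * q ^ n) (q * deriv F q) := by
      rw [← hasSum_nat_add_iff' 1]
      simp only [Finset.range_one, Finset.sum_singleton, Nat.cast_zero, zero_mul, sub_zero]
      refine h2.congr_fun fun n => ?_
      rw [PowerSeries.coeff_mk]
      push_cast
      ring
    rw [mul_left_comm, ← mul_add]
    refine (((h1.mul_left (r : ℂ)).add h3).mul_left (qPow r z)).congr_fun fun n => ?_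
    rw [qPow_add, qPow_natCast, PowerSeries.coeff_map]
    simp only [eq_ratCast]
    push_cast
    ring

theorem mdiff (hf : HasQExp r p f) : MDiff f := fun z =>
  UpperHalfPlane.mdifferentiableAt_iff.mpr
    (hf.exists_hasDerivAt z).choose_spec.1.differentiableAt

/-- Differentiation multiplies the coefficient of `q^(r+n)` by `r + n`. -/
theorem deriv (hf : HasQExp r p f) :
    HasQExp r (PowerSeries.mk fun n : ℕ => (r + n) * p.coeff n) (D f) := by
  intro z
  obtain ⟨d, h1, h2⟩ := hf.exists_hasDerivAt z
  rw [Derivative.normalizedDerivOfComplex, h1.deriv, inv_mul_cancel_left₀ (by simp [Real.pi_ne_zero])]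
  simpa only [PowerSeries.coeff_mk] using h2

theorem vadd_one (hf : HasQExp r p f) (z : ℍ) :
    f ((1 : ℝ) +ᵥ z) = cexp (2 * Real.pi * I * r) * f z := by
  refine (hf _).unique (((hf z).mul_left _).congr_fun fun n => ?_)
  simp only [qPow]
  have h1 : cexp (2 * Real.pi * I * n) = 1 := by
    rw [mul_comm]; exact Complex.exp_nat_mul_two_pi_mul_I n
  rw [mul_left_comm, ← Complex.exp_add]
  congr 1
  rw [coe_vadd]
  push_cast
  rw [show (2 * Real.pi * I * (r + n) * (1 + z) : ℂ) =
    2 * Real.pi * I * n + (2 * Real.pi * I * r + 2 * Real.pi * I * (r + n) * z) by ring,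
    Complex.exp_add, h1, one_mul]

theorem hasSum_qParam (hf : HasQExp 0 p f) (z : ℍ) :
    HasSum (fun n => (toC p).coeff n • Function.Periodic.qParam 1 z ^ n) (f z) :=
  (hf z).congr_fun fun n => by
    rw [zero_add, qPow_natCast, qPow_one, PowerSeries.coeff_map]; simp

theorem isBoundedAtImInfty (hf : HasQExp 0 p f) : IsBoundedAtImInfty f :=
  isBoundedAtImInfty_of_hasSum_qExpansion (c := fun n => (toC p).coeff n) one_pos hf.hasSum_qParam

theorem qExpansion_eq {k : ℤ} (F : ModularForm 𝒮ℒ k) (hF : HasQExp 0 p F) :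
    qExpansion 1 F = toC p := by
  ext n
  exact (ModularFormClass.qExpansion_coeff_unique one_pos one_mem_strictPeriods_SL
    hF.hasSum_qParam n).symm

theorem of_qExpansion {k : ℤ} (F : ModularForm 𝒮ℒ k) (hF : qExpansion 1 F = toC p) :
    HasQExp 0 p F := by
  intro z
  refine (ModularForm.hasSum_qExpansion F one_pos one_mem_strictPeriods_SL z).congr_fun
    fun n => ?_
  rw [hF, zero_add, qPow_natCast, qPow_one, PowerSeries.coeff_map]; simp

open ModularForm in
/-- A function with an expansion in nonnegative integral powers of `q` and the right behaviour under
`z ↦ -1/z` is a modular form of level one. -/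
theorem exists_modularForm (hf : HasQExp 0 p f) {k : ℤ} (hS : f ∣[k] ModularGroup.S = f) :
    ∃ F : ModularForm 𝒮ℒ k, ⇑F = f := by
  have hT : f ∣[k] ModularGroup.T = f := by
    ext z
    rw [SL_slash_apply, ModularGroup.denom_apply, modular_T_smul, hf.vadd_one]
    simp [ModularGroup.T]
  have hinv := SlashInvariantForm.slash_action_generators_SL2Z hS hT
  exact ⟨{
    toFun := f
    slash_action_eq' := by
      rintro _ ⟨γ, rfl⟩
      exact hinv γ
    holo' := hf.mdiff
    bdd_at_cusps' := fun hc => by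
      rw [Subgroup.IsArithmetic.isCusp_iff_isCusp_SL2Z] at hc
      rw [OnePoint.isBoundedAt_iff_forall_SL2Z hc]
      intro γ _
      rw [hinv]
      exact hf.isBoundedAtImInfty }, rfl⟩

/-- A nonzero `q`-expansion has a leading coefficient. -/
theorem exists_hasLeadingCoeff (hf : HasQExp r p f) (h0 : f ≠ 0) : ∃ c, HasLeadingCoeff f c := by
  have hp : p ≠ 0 := by
    rintro rfl
    exact h0 (funext fun z => (hf z).unique (HasQExp.zero z))
  set m := p.order.toNat with hm
  obtain ⟨v, hv⟩ := PowerSeries.X_pow_order_dvd (φ := p)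
  rw [← hm] at hv
  refine ⟨(p.coeff m : ℚ), by simpa [hm] using PowerSeries.coeff_order hp, r + m,
    fun n => (p.coeff (n + m) : ℚ), by simp, fun z => ?_⟩
  have h1 := hf z
  rw [← hasSum_nat_add_iff' m] at h1
  rw [Finset.sum_eq_zero, sub_zero] at h1
  · refine h1.congr_fun fun n => ?_
    push_cast
    rw [add_right_comm, add_assoc r]
  · intro i hi
    rw [hv, PowerSeries.coeff_X_pow_mul', if_neg (by simpa using hi)]
    simp

end HasQExp

open Filter

/-! ### The Jacobi triple product -/

/-- The Gaussian binomial coefficient at `q`, by its Pascal recursion. -/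
def gaussBinom (q : ℂ) : ℕ → ℕ → ℂ
  | _, 0 => 1
  | 0, _ + 1 => 0
  | n + 1, j + 1 => gaussBinom q n j + q ^ (j + 1) * gaussBinom q n (j + 1)

/-- The finite `q`-factorial `(q; q)_n = ∏_{i < n} (1 - q^(i+1))`. -/
def qFactorial (q : ℂ) (n : ℕ) : ℂ := ∏ i ∈ Finset.range n, (1 - q ^ (i + 1))

@[simp] theorem gaussBinom_zero_right (q : ℂ) (n : ℕ) : gaussBinom q n 0 = 1 := by
  cases n <;> rfl

theorem gaussBinom_succ_succ (q : ℂ) (n j : ℕ) : gaussBinom q (n + 1) (j + 1) =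
    gaussBinom q n j + q ^ (j + 1) * gaussBinom q n (j + 1) := rfl

theorem gaussBinom_eq_zero (q : ℂ) {n j : ℕ} (h : n < j) : gaussBinom q n j = 0 := by
  induction n generalizing j with
  | zero => cases j with
    | zero => omega
    | succ j => rfl
  | succ n ih => cases j with
    | zero => omega
    | succ j => rw [gaussBinom_succ_succ, ih (by omega), ih (by omega)]; simp

/-- The closed form of the Gaussian binomial coefficient, without division. -/
theorem gaussBinom_mul_qFactorial (q : ℂ) (a b : ℕ) :
    gaussBinom q (a + b) a * (qFactorial q a * qFactorial q b) = qFactorial q (a + b) := by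
  induction h : a + b generalizing a b with
  | zero =>
    obtain ⟨rfl, rfl⟩ : a = 0 ∧ b = 0 := by omega
    simp [qFactorial]
  | succ n ih =>
    rcases a with _ | a
    · obtain rfl : b = n + 1 := by omega
      simp [qFactorial]
    rw [gaussBinom_succ_succ]
    rcases b with _ | b
    · obtain rfl : a = n := by omega
      rw [gaussBinom_eq_zero q (Nat.lt_succ_self a)]
      have := ih a 0 rfl
      simp only [qFactorial, Finset.prod_range_succ, Finset.prod_range_zero] at this ⊢
      linear_combination (1 - q ^ (a + 1)) * this
    · have h1 := ih a (b + 1) (by omega)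
      have h2 := ih (a + 1) b (by omega)
      have hn : n = a + b + 1 := by omega
      have e1 (m : ℕ) : qFactorial q (m + 1) = qFactorial q m * (1 - q ^ (m + 1)) := by
        simp [qFactorial, Finset.prod_range_succ]
      rw [e1 n]
      rw [e1 b] at h1 ⊢
      rw [e1 a] at h2 ⊢
      have h3 : q ^ (n + 1) = q ^ (a + 1) * q ^ (b + 1) := by rw [← pow_add]; congr 1; omega
      rw [h3]
      linear_combination (1 - q ^ (a + 1)) * h1 + q ^ (a + 1) * (1 - q ^ (b + 1)) * h2

/-- The `q`-binomial theorem. -/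
theorem prod_one_add_mul_pow (q y : ℂ) (n : ℕ) :
    ∏ i ∈ Finset.range n, (1 + y * q ^ i) =
      ∑ j ∈ Finset.range (n + 1), gaussBinom q n j * q ^ (j.choose 2) * y ^ j := by
  induction n generalizing y with
  | zero => simp
  | succ n ih =>
    rw [Finset.prod_range_succ']
    have h1 : ∏ i ∈ Finset.range n, (1 + y * q ^ (i + 1)) =
        ∏ i ∈ Finset.range n, (1 + y * q * q ^ i) :=
      Finset.prod_congr rfl fun i _ => by ring
    rw [h1, ih, Finset.sum_range_succ' _ (n + 1)]
    have h2 : ∀ j, gaussBinom q (n + 1) (j + 1) * q ^ ((j + 1).choose 2) * y ^ (j + 1) =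
        gaussBinom q n j * q ^ (j.choose 2) * (y * q) ^ j * y +
        gaussBinom q n (j + 1) * q ^ ((j + 1).choose 2) * (y * q) ^ (j + 1) := by
      intro j
      rw [gaussBinom_succ_succ, Nat.choose_succ_succ' j 1, Nat.choose_one_right]
      ring
    simp_rw [h2]
    rw [Finset.sum_add_distrib, ← Finset.sum_mul, add_assoc]
    have h3 : gaussBinom q n (n + 1) = 0 := gaussBinom_eq_zero q (Nat.lt_succ_self n)
    have h4 := Finset.sum_range_succ'
      (fun j => gaussBinom q n j * q ^ (j.choose 2) * (y * q) ^ j) (n + 1)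
    rw [Finset.sum_range_succ, h3] at h4
    simp only [zero_mul, add_zero] at h4
    simp only [Nat.choose_zero_succ, gaussBinom_zero_right, pow_zero, mul_one] at h4 ⊢
    rw [← h4]
    ring

/-- The finite form of the triple product. The terms `T j` stand for `(-x)^j q^(j(j-1)/2)`. -/
theorem prod_finite_triple {q x : ℂ} (hq : q ≠ 0) (hx : x ≠ 0) {T : ℤ → ℂ} (h0 : T 0 = 1)
    (hT : ∀ j, T (j + 1) = -x * q ^ j * T j) (n : ℕ) :
    ∏ i ∈ Finset.range n, ((1 - x * q ^ i) * (1 - x⁻¹ * q ^ (i + 1))) =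
      ∑ j ∈ Finset.range (2 * n + 1), gaussBinom q (2 * n) j * T (j - n) := by
  have hbase (m : ℕ) : (∏ i ∈ Finset.range m, (-x * q ^ (-(i + 1) : ℤ))) * T (-m) = 1 := by
    induction m with
    | zero => simpa using h0
    | succ m ih =>
      have := hT (-(m + 1 : ℕ))
      rw [show (-((m + 1 : ℕ) : ℤ) + 1) = -m by push_cast; ring] at this
      rw [Finset.prod_range_succ, mul_assoc, ← ih, this]
      push_cast
      ring
  -- the substitution `y = -x q^(-n)` in the `q`-binomial theorem of order `2n`
  set y : ℂ := -x * q ^ (-n : ℤ) with hy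
  set c : ℂ := ∏ i ∈ Finset.range n, (-x * q ^ (-(i + 1) : ℤ)) with hc
  have hc0 : c ≠ 0 := Finset.prod_ne_zero_iff.mpr fun i _ =>
    mul_ne_zero (neg_ne_zero.mpr hx) (zpow_ne_zero _ hq)
  have hterm : ∀ j : ℕ, c * T (j - n) = q ^ (j.choose 2) * y ^ j := by
    intro j
    induction j with
    | zero =>
      rw [Nat.cast_zero, zero_sub, Nat.choose_zero_succ, pow_zero, pow_zero, mul_one]
      exact hbase n
    | succ j ih =>
      have h1 := hT (j - n)
      rw [show (((j + 1 : ℕ) : ℤ) - n) = j - n + 1 by push_cast; ring, h1, mul_left_comm, ih,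
        Nat.choose_succ_succ' j 1, Nat.choose_one_right, pow_add, pow_succ, hy, sub_eq_add_neg,
        zpow_add₀ hq, zpow_natCast]
      ring
  have hprod : ∏ i ∈ Finset.range (2 * n), (1 + y * q ^ i) =
      c * ∏ i ∈ Finset.range n, ((1 - x * q ^ i) * (1 - x⁻¹ * q ^ (i + 1))) := by
    rw [two_mul, Finset.prod_range_add, ← Finset.prod_range_reflect, hc,
      Finset.prod_mul_distrib (f := fun i => 1 - x * q ^ i),
      mul_comm (∏ i ∈ Finset.range n, (1 - x * q ^ i)), ← mul_assoc]
    refine congrArg₂ (· * ·) ?_ ?_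
    · rw [← Finset.prod_mul_distrib]
      refine Finset.prod_congr rfl fun i hi => ?_
      have hi := Finset.mem_range.mp hi
      have h1 : q ^ (-n : ℤ) * q ^ (n - 1 - i) = q ^ (-(i + 1) : ℤ) := by
        rw [← zpow_natCast, ← zpow_add₀ hq]; congr 1; omega
      have h2 : q ^ (-(i + 1) : ℤ) * q ^ (i + 1) = 1 := by
        rw [← zpow_natCast, ← zpow_add₀ hq]; simp
      rw [hy, mul_assoc, h1]
      field_simp
      linear_combination (-1 : ℂ) * h2
    · refine Finset.prod_congr rfl fun i _ => ?_
      have h1 : q ^ (-n : ℤ) * q ^ (n + i) = q ^ i := by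
        rw [← zpow_natCast, ← zpow_add₀ hq, ← zpow_natCast]; congr 1; push_cast; ring
      rw [hy, mul_assoc, h1]; ring
  refine mul_left_cancel₀ hc0 ?_
  rw [← hprod, prod_one_add_mul_pow, Finset.mul_sum]
  refine Finset.sum_congr rfl fun j _ => ?_
  rw [mul_left_comm, hterm, mul_assoc]

theorem tendsto_qFactorial {q : ℂ} (hq : ‖q‖ < 1) :
    Tendsto (qFactorial q) atTop (𝓝 (∏' n : ℕ, (1 - q ^ (n + 1)))) :=
  (ModularForm.multipliable_one_sub_pow hq).hasProd.tendsto_prod_nat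

theorem one_sub_pow_ne_zero {q : ℂ} (hq : ‖q‖ < 1) (n : ℕ) : 1 - q ^ (n + 1) ≠ 0 := by
  intro h
  have h1 : q ^ (n + 1) = 1 := (sub_eq_zero.mp h).symm
  have h2 := pow_lt_one₀ (norm_nonneg q) hq (Nat.succ_ne_zero n)
  rw [← norm_pow, h1, norm_one] at h2
  exact lt_irrefl _ h2

theorem qFactorial_ne_zero {q : ℂ} (hq : ‖q‖ < 1) (n : ℕ) : qFactorial q n ≠ 0 :=
  Finset.prod_ne_zero_iff.mpr fun i _ => one_sub_pow_ne_zero hq i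

theorem tprod_one_sub_pow_ne_zero {q : ℂ} (hq : ‖q‖ < 1) : ∏' n : ℕ, (1 - q ^ (n + 1)) ≠ 0 := by
  simp_rw [sub_eq_add_neg]
  refine tprod_one_add_ne_zero_of_summable (f := fun n : ℕ ↦ -q ^ (n + 1)) ?_ ?_
  · exact fun i ↦ by simpa [sub_eq_add_neg] using one_sub_pow_ne_zero hq i
  · simpa using (summable_nat_add_iff 1).mpr (summable_geometric_of_lt_one (norm_nonneg _) hq)

/-- The **Jacobi triple product**: with `q = e^{2πiτ}` and `x = e^{2πiw}`, the product
`∏ (1 - q^(n+1)) (1 - x q^n) (1 - x⁻¹ q^(n+1))` equals `∑_{j ∈ ℤ} (-x)^j q^(j(j-1)/2)`. -/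
theorem tendsto_prod_triple {τ : ℂ} (hτ : 0 < τ.im) (w : ℂ) :
    Tendsto (fun n => ∏ i ∈ Finset.range n, ((1 - cexp (2 * Real.pi * I * τ) ^ (i + 1)) *
      ((1 - cexp (2 * Real.pi * I * w) * cexp (2 * Real.pi * I * τ) ^ i) *
        (1 - (cexp (2 * Real.pi * I * w))⁻¹ * cexp (2 * Real.pi * I * τ) ^ (i + 1))))) atTop
      (𝓝 (jacobiTheta₂ (w + 1 / 2 - τ / 2) τ)) := by
  set q := cexp (2 * Real.pi * I * τ) with hq
  set x := cexp (2 * Real.pi * I * w) with hx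
  set T : ℤ → ℂ := fun j => jacobiTheta₂_term j (w + 1 / 2 - τ / 2) τ with hTdef
  have hq0 : q ≠ 0 := Complex.exp_ne_zero _
  have hx0 : x ≠ 0 := Complex.exp_ne_zero _
  have hq1 : ‖q‖ < 1 := by
    have := norm_exp_two_pi_I_lt_one ⟨τ, hτ⟩
    simpa [hq] using this
  have hT0 : T 0 = 1 := by simp [hTdef, jacobiTheta₂_term]
  have hT : ∀ j, T (j + 1) = -x * q ^ j * T j := by
    intro j
    simp only [hTdef, jacobiTheta₂_term, hx, hq]
    rw [← Complex.exp_int_mul, neg_mul, neg_mul, ← Complex.exp_add, ← Complex.exp_add,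
      ← neg_one_mul, ← Complex.exp_pi_mul_I, ← Complex.exp_add]
    congr 1
    push_cast
    ring
  set L := ∏' n : ℕ, (1 - q ^ (n + 1))
  have hL0 : L ≠ 0 := tprod_one_sub_pow_ne_zero hq1
  have hL := tendsto_qFactorial hq1
  obtain ⟨C₁, hC₁⟩ := (Metric.isBounded_range_of_tendsto _ hL).exists_norm_le
  obtain ⟨C₂, hC₂⟩ := (Metric.isBounded_range_of_tendsto _ (hL.inv₀ hL0)).exists_norm_le
  have hC₁' (n) : ‖qFactorial q n‖ ≤ C₁ := hC₁ _ ⟨n, rfl⟩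
  have hC₂' (n) : ‖(qFactorial q n)⁻¹‖ ≤ C₂ := hC₂ _ ⟨n, rfl⟩
  have hC₁0 : 0 ≤ C₁ := (norm_nonneg _).trans (hC₁' 0)
  have hC₂0 : 0 ≤ C₂ := (norm_nonneg _).trans (hC₂' 0)
  have hG (a b : ℕ) : gaussBinom q (a + b) a =
      qFactorial q (a + b) * (qFactorial q a)⁻¹ * (qFactorial q b)⁻¹ := by
    have h1 := qFactorial_ne_zero hq1 a
    have h2 := qFactorial_ne_zero hq1 b
    rw [← gaussBinom_mul_qFactorial q a b]
    field_simp
  -- the coefficients of the finite identity, extended by zero to all of `ℤ`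
  set g : ℕ → ℤ → ℂ := fun n j =>
    if -(n : ℤ) ≤ j ∧ j ≤ n then gaussBinom q (2 * n) (j + n).toNat else 0 with hg
  have hgval (n : ℕ) (j : ℤ) (h : -(n : ℤ) ≤ j ∧ j ≤ n) : g n j = qFactorial q (2 * n) *
      (qFactorial q (n + j).toNat)⁻¹ * (qFactorial q (n - j).toNat)⁻¹ := by
    have h1 := hG (n + j).toNat (n - j).toNat
    rw [show (n + j).toNat + (n - j).toNat = 2 * n by omega] at h1
    rw [hg]; simp only
    rw [if_pos h, add_comm j, h1]
  have hlim : Tendsto (fun n => ∑' j : ℤ, g n j * T j) atTop (𝓝 (∑' j : ℤ, L⁻¹ * T j)) := by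
    refine tendsto_tsum_of_dominated_convergence (bound := fun j => C₁ * C₂ * C₂ * ‖T j‖) ?_ ?_ ?_
    · exact (((summable_jacobiTheta₂_term_iff _ _).mpr hτ).norm).mul_left _
    · intro j
      refine Tendsto.mul_const _ ?_
      have ht1 : Tendsto (fun n : ℕ => (n + j).toNat) atTop atTop :=
        tendsto_atTop.mpr fun b => by
          filter_upwards [eventually_ge_atTop (b + j.natAbs)] with n hn; omega
      have ht2 : Tendsto (fun n : ℕ => (n - j).toNat) atTop atTop :=
        tendsto_atTop.mpr fun b => by
          filter_upwards [eventually_ge_atTop (b + j.natAbs)] with n hn; omega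
      have ht3 : Tendsto (fun n : ℕ => 2 * n) atTop atTop :=
        tendsto_atTop.mpr fun b => by filter_upwards [eventually_ge_atTop b] with n hn; omega
      have := ((hL.comp ht3).mul ((hL.comp ht1).inv₀ hL0)).mul ((hL.comp ht2).inv₀ hL0)
      rw [mul_inv_cancel₀ hL0, one_mul] at this
      refine this.congr' ?_
      filter_upwards [eventually_ge_atTop j.natAbs] with n hn
      exact (hgval n j (by omega)).symm
    · refine Eventually.of_forall fun n j => ?_
      rw [norm_mul]
      refine mul_le_mul_of_nonneg_right ?_ (norm_nonneg _)
      by_cases h : -(n : ℤ) ≤ j ∧ j ≤ n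
      · rw [hgval n j h, norm_mul, norm_mul]
        exact mul_le_mul (mul_le_mul (hC₁' _) (hC₂' _) (norm_nonneg _) hC₁0) (hC₂' _)
          (norm_nonneg _) (by positivity)
      · rw [hg]; simp only
        rw [if_neg h, norm_zero]; positivity
  have hfin (n : ℕ) : ∑' j : ℤ, g n j * T j =
      ∏ i ∈ Finset.range n, ((1 - x * q ^ i) * (1 - x⁻¹ * q ^ (i + 1))) := by
    rw [prod_finite_triple hq0 hx0 hT0 hT, tsum_eq_sum (s := Finset.Icc (-n : ℤ) n)]
    · refine Finset.sum_bij' (fun j _ => (j + n).toNat) (fun j _ => (j : ℤ) - n) ?_ ?_ ?_ ?_ ?_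
      · intro j hj
        simp only [Finset.mem_Icc, Finset.mem_range] at hj ⊢; omega
      · intro j hj
        simp only [Finset.mem_Icc, Finset.mem_range] at hj ⊢; omega
      · intro j hj
        simp only [Finset.mem_Icc] at hj; omega
      · intro j hj
        simp only [Finset.mem_range] at hj; omega
      · intro j hj
        simp only [Finset.mem_Icc] at hj
        rw [hg]; simp only
        rw [if_pos hj]
        congr 2
        omega
    · intro j hj
      simp only [Finset.mem_Icc] at hj
      rw [hg]; simp only
      rw [if_neg hj, zero_mul]
  simp_rw [hfin] at hlim
  have := hL.mul hlim
  rw [tsum_mul_left, ← mul_assoc, mul_inv_cancel₀ hL0, one_mul] at this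
  refine this.congr fun n => ?_
  rw [qFactorial, ← Finset.prod_mul_distrib]

/-! ### The characters as quotients of theta series -/

/-- The exponent `(2k+1-2i)² / (8(2k+1)) = h_{i,k} - c_k/24 + 1/24` of the theta series. -/
def thetaExponent (k i : ℕ) : ℚ := (2 * (k : ℚ) + 1 - 2 * i) ^ 2 / (8 * (2 * k + 1))

/-- The theta series `∑_{n ∈ ℤ} (-1)^n q^((m/2) (n + i/m - 1/2)²)` with `m = 2k+1`, written through
Mathlib's two-variable theta function. -/
def theta (k i : ℕ) (z : ℍ) : ℂ :=
  qPow (thetaExponent k i) z *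
    jacobiTheta₂ (i * z + 1 / 2 - (2 * k + 1) * z / 2) ((2 * k + 1) * z)

theorem im_mul_pos (k : ℕ) (z : ℍ) : 0 < ((2 * k + 1) * z : ℂ).im := by
  have h : ((2 * k + 1) * z : ℂ).im = (2 * k + 1) * z.im := by
    rw [show (2 * k + 1 : ℂ) = ((2 * k + 1 : ℝ) : ℂ) by push_cast; rfl, Complex.im_ofReal_mul]; rfl
  rw [h]
  have := z.im_pos
  positivity

theorem hasSum_theta (k i : ℕ) (z : ℍ) :
    HasSum (fun n : ℤ => cexp (Real.pi * I * n + Real.pi * I * z *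
      (2 * (2 * k + 1) * n + (2 * i - (2 * k + 1))) ^ 2 / (4 * (2 * k + 1)))) (theta k i z) := by
  refine ((hasSum_jacobiTheta₂_term _ (im_mul_pos k z)).mul_left _).congr_fun fun n => ?_
  have h : (2 * k + 1 : ℂ) ≠ 0 := by exact_mod_cast Nat.succ_ne_zero (2 * k)
  rw [qPow, jacobiTheta₂_term, ← Complex.exp_add]
  congr 1
  simp only [thetaExponent]
  push_cast
  field_simp
  ring

/-- The factor `1 - q^(n+1)` if `n + 1 ≡ 0, ±i (mod 2k+1)`, and `1` otherwise. -/
def sieveFactor (k i : ℕ) (q : ℂ) (n : ℕ) : ℂ :=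
  if ((n + 1 : ℕ) : ZMod (2 * k + 1)) ≠ 0 ∧ ((n + 1 : ℕ) : ZMod (2 * k + 1)) ≠ (i : ZMod (2 * k + 1)) ∧
      ((n + 1 : ℕ) : ZMod (2 * k + 1)) ≠ -(i : ZMod (2 * k + 1))
  then 1 else 1 - q ^ (n + 1)

theorem multipliable_sieveFactor (k i : ℕ) {q : ℂ} (hq : ‖q‖ < 1) :
    Multipliable (sieveFactor k i q) := by
  have h : sieveFactor k i q = fun n => 1 + (sieveFactor k i q n - 1) := by funext n; ring
  rw [h]
  refine multipliable_one_add_of_summable ?_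
  refine Summable.of_nonneg_of_le (fun _ => norm_nonneg _) (fun n => ?_)
    ((summable_nat_add_iff 1).mpr (summable_geometric_of_lt_one (norm_nonneg q) hq))
  rw [sieveFactor]
  split_ifs
  · simp
  · simp

/-- One period of `2k+1` consecutive factors contains exactly one from each of the distinct residue
classes `0`, `i` and `-i`. -/
theorem prod_sieveFactor_block {k i : ℕ} (h1 : 1 ≤ i) (h2 : i ≤ k) (q : ℂ) (a : ℕ) :
    ∏ r ∈ Finset.range (2 * k + 1), sieveFactor k i q ((2 * k + 1) * a + r) =
      (1 - q ^ ((2 * k + 1) * (a + 1))) * ((1 - q ^ ((2 * k + 1) * a + i)) *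
        (1 - q ^ ((2 * k + 1) * (a + 1) - i))) := by
  have hmod (r : ℕ) (hr : r < 2 * k + 1) (s : ℕ) (hs1 : 1 ≤ s) (hs2 : s ≤ 2 * k + 1) :
      (((2 * k + 1) * a + r + 1 : ℕ) : ZMod (2 * k + 1)) = (s : ZMod (2 * k + 1)) ↔ r + 1 = s := by
    have h0 : (((2 * k + 1) * a + r + 1 : ℕ) : ZMod (2 * k + 1)) =
        ((r + 1 : ℕ) : ZMod (2 * k + 1)) := by
      have := ZMod.natCast_self (2 * k + 1)
      push_cast at this ⊢
      rw [this]; ring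
    rw [h0, ZMod.natCast_eq_natCast_iff']
    constructor
    · intro h
      rcases (show r + 1 < 2 * k + 1 ∨ r + 1 = 2 * k + 1 by omega) with h3 | h3 <;>
      rcases (show s < 2 * k + 1 ∨ s = 2 * k + 1 by omega) with h4 | h4
      · rwa [Nat.mod_eq_of_lt h3, Nat.mod_eq_of_lt h4] at h
      · rw [Nat.mod_eq_of_lt h3, h4, Nat.mod_self] at h; omega
      · rw [Nat.mod_eq_of_lt h4, h3, Nat.mod_self] at h; omega
      · omega
    · rintro rfl; rfl
  have hm0 : ((2 * k + 1 : ℕ) : ZMod (2 * k + 1)) = 0 := ZMod.natCast_self _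
  have hmi : ((2 * k + 1 - i : ℕ) : ZMod (2 * k + 1)) = -(i : ZMod (2 * k + 1)) := by
    rw [Nat.cast_sub (by omega), hm0, zero_sub]
  have hval (r : ℕ) (hr : r < 2 * k + 1) : sieveFactor k i q ((2 * k + 1) * a + r) =
      if r ∈ ({2 * k, i - 1, 2 * k - i} : Finset ℕ) then 1 - q ^ ((2 * k + 1) * a + r + 1) else 1 := by
    have e1 := hmod r hr (2 * k + 1) (by omega) le_rfl
    have e2 := hmod r hr i (by omega) (by omega)
    have e3 := hmod r hr (2 * k + 1 - i) (by omega) (by omega)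
    rw [sieveFactor, ← hm0, ← hmi]
    simp only [ne_eq, e1, e2, e3, Finset.mem_insert, Finset.mem_singleton]
    split_ifs <;> first | rfl | omega
  rw [Finset.prod_congr rfl fun r hr => hval r (Finset.mem_range.mp hr), Finset.prod_ite_mem,
    Finset.inter_eq_right.mpr, Finset.prod_insert, Finset.prod_insert, Finset.prod_singleton]
  · have e0 : (2 * k + 1) * (a + 1) = (2 * k + 1) * a + (2 * k + 1) := by ring
    rw [e0, show (2 * k + 1) * a + (i - 1) + 1 = (2 * k + 1) * a + i by omega,
      show (2 * k + 1) * a + (2 * k - i) + 1 = (2 * k + 1) * a + (2 * k + 1) - i by omega, add_assoc]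
  · simp only [Finset.mem_singleton]; omega
  · simp only [Finset.mem_insert, Finset.mem_singleton]; omega
  · intro r
    simp only [Finset.mem_insert, Finset.mem_singleton, Finset.mem_range]; omega

/-- The triple product for the residues `0, ±i` modulo `2k+1`. -/
theorem hasProd_sieveFactor {k i : ℕ} (h1 : 1 ≤ i) (h2 : i ≤ k) (z : ℍ) :
    HasProd (sieveFactor k i (qPow 1 z))
      (jacobiTheta₂ (i * z + 1 / 2 - (2 * k + 1) * z / 2) ((2 * k + 1) * z)) := by
  have hmul := (multipliable_sieveFactor k i (norm_qPow_one_lt z)).hasProd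
  have ht := hmul.tendsto_prod_nat
  have hN : Tendsto (fun N => (2 * k + 1) * N) atTop atTop :=
    tendsto_atTop.mpr fun b => by
      filter_upwards [eventually_ge_atTop b] with n hn; nlinarith
  have hblock (N : ℕ) : ∏ n ∈ Finset.range ((2 * k + 1) * N), sieveFactor k i (qPow 1 z) n =
      ∏ a ∈ Finset.range N, ((1 - qPow 1 z ^ ((2 * k + 1) * (a + 1))) *
        ((1 - qPow 1 z ^ ((2 * k + 1) * a + i)) * (1 - qPow 1 z ^ ((2 * k + 1) * (a + 1) - i)))) := by
    induction N with
    | zero => simp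
    | succ N ih =>
      rw [Finset.prod_range_succ, ← ih, ← prod_sieveFactor_block h1 h2, mul_add, mul_one,
        Finset.prod_range_add]
  have ht2 := tendsto_prod_triple (im_mul_pos k z) (i * z)
  have hq : ∀ n : ℕ, cexp (2 * Real.pi * I * (n * z)) = qPow 1 z ^ n := by
    intro n
    rw [← qPow_natCast, qPow]; congr 1; push_cast; ring
  have hq' : cexp (2 * Real.pi * I * ((2 * k + 1) * z)) = qPow 1 z ^ (2 * k + 1) := by
    rw [← hq]; push_cast; rfl
  have ht3 := (ht.comp hN)
  simp only [Function.comp_def, hblock] at ht3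
  rw [← tendsto_nhds_unique ht3 (ht2.congr fun N => Finset.prod_congr rfl fun a _ => ?_)]
  · exact hmul
  · rw [hq', hq]
    have h0 := qPow_ne_zero 1 z
    rw [← pow_mul, ← pow_mul, ← pow_add, add_comm i]
    congr 3
    have h3 : (2 * k + 1) * (a + 1) = ((2 * k + 1) * (a + 1) - i) + i := by
      have : (2 * k + 1) * (a + 1) = (2 * k + 1) * a + (2 * k + 1) := by ring
      omega
    nth_rw 1 [h3]
    rw [pow_add, mul_comm, mul_assoc, mul_inv_cancel₀ (pow_ne_zero _ h0), mul_one]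

theorem eta_eq (z : ℍ) : ModularForm.eta z =
    qPow (1 / 24) z * ∏' n : ℕ, (1 - qPow 1 z ^ (n + 1)) := by
  simp only [ModularForm.eta, ModularForm.eta_q, qPow_one]
  congr 1
  rw [qPow, Function.Periodic.qParam]
  congr 1
  push_cast
  ring

theorem eta_ne_zero (z : ℍ) : ModularForm.eta z ≠ 0 := ModularForm.eta_ne_zero z.2

/-- The Dedekind eta function is the theta series with `m = 3` (Euler's pentagonal number
theorem). -/
theorem theta_one_one (z : ℍ) : theta 1 1 z = ModularForm.eta z := by
  rw [eta_eq, theta, ← (hasProd_sieveFactor le_rfl le_rfl z).tprod_eq]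
  refine congrArg₂ (· * ·) ?_ (tprod_congr fun n => ?_)
  · norm_num [thetaExponent]
  · rw [sieveFactor, if_neg]
    generalize ((n + 1 : ℕ) : ZMod (2 * 1 + 1)) = x
    revert x
    decide

theorem weight_sub_centralCharge (k i : ℕ) :
    weight k i - centralCharge k / 24 = thetaExponent k i - 1 / 24 := by
  have : (2 * (k : ℚ) + 1) ≠ 0 := by positivity
  simp only [weight, centralCharge, thetaExponent]
  field_simp
  ring

theorem character_mul_eta {k i : ℕ} (h1 : 1 ≤ i) (h2 : i ≤ k) (z : ℍ) :
    character k i z * ModularForm.eta z = theta k i z := by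
  have hq := norm_qPow_one_lt z
  have hE := (ModularForm.multipliable_one_sub_pow hq).hasProd
  have hE0 := tprod_one_sub_pow_ne_zero hq
  have hS := hasProd_sieveFactor h1 h2 z
  have hdiv := (hS.div₀ hE hE0).tprod_eq
  have hprod : (∏' n : ℕ+, if ((n : ℕ) : ZMod (2 * k + 1)) ≠ 0 ∧
      ((n : ℕ) : ZMod (2 * k + 1)) ≠ (i : ZMod (2 * k + 1)) ∧
        ((n : ℕ) : ZMod (2 * k + 1)) ≠ -(i : ZMod (2 * k + 1))
      then (1 - qPow ((n : ℕ) : ℚ) z)⁻¹ else 1) =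
      jacobiTheta₂ (i * z + 1 / 2 - (2 * k + 1) * z / 2) ((2 * k + 1) * z) /
        ∏' n : ℕ, (1 - qPow 1 z ^ (n + 1)) := by
    rw [← hdiv, tprod_pnat_eq_tprod_succ (f := fun n : ℕ => if ((n : ℕ) : ZMod (2 * k + 1)) ≠ 0 ∧
      ((n : ℕ) : ZMod (2 * k + 1)) ≠ (i : ZMod (2 * k + 1)) ∧
        ((n : ℕ) : ZMod (2 * k + 1)) ≠ -(i : ZMod (2 * k + 1))
      then (1 - qPow ((n : ℕ) : ℚ) z)⁻¹ else 1)]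
    refine tprod_congr fun n => ?_
    rw [sieveFactor]
    have := one_sub_pow_ne_zero hq n
    split_ifs
    · rw [qPow_natCast, one_div]
    · rw [div_self this]
  rw [character, hprod, weight_sub_centralCharge, eta_eq, theta, sub_eq_add_neg, qPow_add, qPow_neg]
  have := qPow_ne_zero (1 / 24) z
  field_simp

/-! ### `q`-expansions of the characters -/

theorem exists_hasQExp_theta {k i : ℕ} (h1 : 1 ≤ i) (h2 : i ≤ k) :
    ∃ p : PowerSeries ℚ, p.constantCoeff = 1 ∧ HasQExp (thetaExponent k i) p (theta k i) := by
  -- the integral exponents `i n + (2k+1) n(n-1)/2` of the triple product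
  have hev (n : ℤ) : (2 : ℤ) ∣ n * (n - 1) := by
    rcases Int.even_or_odd n with ⟨m, rfl⟩ | ⟨m, rfl⟩
    · exact ⟨m * (m + m - 1), by ring⟩
    · exact ⟨m * (2 * m + 1), by ring⟩
  have hex (n : ℤ) : ∃ N : ℕ, 2 * (N : ℤ) = 2 * i * n + (2 * k + 1) * (n * (n - 1)) := by
    obtain ⟨t, ht⟩ := hev n
    have : 0 ≤ i * n + (2 * k + 1) * t := by
      have h3 : (1 : ℤ) ≤ i := by exact_mod_cast h1
      have h4 : (i : ℤ) ≤ k := by exact_mod_cast h2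
      rcases le_or_gt 0 n with hn | hn
      · have : 0 ≤ t := by
          rcases hn.eq_or_lt with rfl | hn
          · omega
          · nlinarith
        positivity
      · nlinarith [mul_nonneg (show (0 : ℤ) ≤ k - i by omega) (show (0 : ℤ) ≤ -n by omega),
          mul_nonneg (show (0 : ℤ) ≤ 2 * k + 1 by omega) (show (0 : ℤ) ≤ n * (n + 1) by nlinarith)]
    refine ⟨(i * n + (2 * k + 1) * t).toNat, ?_⟩
    rw [Int.toNat_of_nonneg this, ht]; ring
  choose N hN using hex
  have hinj : Function.Injective N := by
    intro a b hab
    have h3 := hN a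
    rw [hab, hN b] at h3
    by_contra hne
    have h4 : (a - b) * (2 * i + (2 * k + 1) * (a + b - 1)) = 0 := by linear_combination -h3
    have h5 := (mul_eq_zero.mp h4).resolve_left (sub_ne_zero.mpr hne)
    have h3 : (1 : ℤ) ≤ i := by exact_mod_cast h1
    have h4 : (i : ℤ) ≤ k := by exact_mod_cast h2
    rcases lt_trichotomy (a + b - 1) 0 with h6 | h6 | h6
    · nlinarith
    · rw [h6] at h5; omega
    · nlinarith
  have hN0 : N 0 = 0 := by have := hN 0; simp at this; exact this
  refine ⟨PowerSeries.mk (Function.extend N (fun n : ℤ => (-1 : ℚ) ^ n) 0), ?_, fun z => ?_⟩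
  · rw [← PowerSeries.coeff_zero_eq_constantCoeff_apply, PowerSeries.coeff_mk, ← hN0,
      hinj.extend_apply]
    simp
  · rw [← hinj.hasSum_iff]
    · refine (hasSum_theta k i z).congr_fun fun n => ?_
      rw [Function.comp_apply, PowerSeries.coeff_mk, hinj.extend_apply, qPow, Complex.exp_add]
      congr 1
      · push_cast
        rw [mul_comm (_ * _ : ℂ) (n : ℂ), Complex.exp_int_mul, Complex.exp_pi_mul_I]
      · congr 1
        have h3 : (2 : ℂ) * (N n : ℂ) = 2 * i * n + (2 * k + 1) * (n * (n - 1)) := by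
          exact_mod_cast congrArg (Int.cast : ℤ → ℂ) (hN n)
        have h : (2 * k + 1 : ℂ) ≠ 0 := by exact_mod_cast Nat.succ_ne_zero (2 * k)
        simp only [thetaExponent]
        push_cast
        rw [show (N n : ℂ) = (2 * i * n + (2 * k + 1) * (n * (n - 1))) / 2 by rw [← h3]; ring]
        field_simp
        ring
    · intro n hn
      rw [PowerSeries.coeff_mk, Function.extend_apply' _ _ _ (by simpa using hn)]
      simp

theorem exists_hasQExp_eta : ∃ p : PowerSeries ℚ, p.constantCoeff = 1 ∧
    HasQExp (1 / 24) p (fun z => ModularForm.eta z) := by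
  obtain ⟨p, h1, h2⟩ := exists_hasQExp_theta (le_refl 1) (le_refl 1)
  refine ⟨p, h1, ?_⟩
  rw [show thetaExponent 1 1 = 1 / 24 by norm_num [thetaExponent]] at h2
  rwa [← funext theta_one_one]

theorem character_eq_div {k i : ℕ} (h1 : 1 ≤ i) (h2 : i ≤ k) :
    character k i = theta k i / fun z : ℍ => ModularForm.eta z := by
  funext z
  rw [Pi.div_apply, ← character_mul_eta h1 h2, mul_div_cancel_right₀ _ (eta_ne_zero z)]

theorem exists_hasQExp_character {k i : ℕ} (h1 : 1 ≤ i) (h2 : i ≤ k) :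
    ∃ p : PowerSeries ℚ, p.constantCoeff = 1 ∧
      HasQExp (thetaExponent k i - 1 / 24) p (character k i) := by
  obtain ⟨p, hp1, hp⟩ := exists_hasQExp_theta h1 h2
  obtain ⟨u, hu1, hu⟩ := exists_hasQExp_eta
  refine ⟨p * u⁻¹, by simp [hp1, hu1], ?_⟩
  rw [character_eq_div h1 h2]
  exact hp.div hu (by simp [hu1]) eta_ne_zero

/-! ### The behaviour of the characters under `z ↦ -1/z` -/

theorem coe_S_smul (z : ℍ) : ((ModularGroup.S • z : ℍ) : ℂ) = -1 / z := by
  rw [UpperHalfPlane.modular_S_smul]; simp [neg_div]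

theorem theta_zero (k : ℕ) (z : ℍ) : theta k 0 z = 0 := by
  have h1 := hasSum_theta k 0 z
  have h2 := (Equiv.subLeft (1 : ℤ)).hasSum_iff.mpr h1
  have h3 : HasSum (fun n : ℤ => -cexp (Real.pi * I * n + Real.pi * I * z *
      (2 * (2 * k + 1) * n + (2 * (0 : ℕ) - (2 * k + 1))) ^ 2 / (4 * (2 * k + 1)))) (theta k 0 z) := by
    refine h2.congr_fun fun n => ?_
    have hexp : cexp (Real.pi * I * ((1 - n : ℤ) : ℂ)) = -cexp (Real.pi * I * n) := by
      rw [mul_comm _ ((1 - n : ℤ) : ℂ), mul_comm _ (n : ℂ), Complex.exp_int_mul,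
        Complex.exp_int_mul, Complex.exp_pi_mul_I, zpow_sub₀ (by norm_num), zpow_one]
      rcases Int.even_or_odd n with h | h
      · simp [h.neg_one_zpow]
      · simp [h.neg_one_zpow]
    rw [Function.comp_apply, Equiv.subLeft_apply, Complex.exp_add, Complex.exp_add, hexp, neg_mul]
    congr 3
    push_cast
    ring
  have h4 := h3.unique h1.neg
  linear_combination h4 / 2

theorem theta_sub (k : ℕ) {i : ℕ} (hi : i ≤ 2 * k + 1) (z : ℍ) :
    theta k (2 * k + 1 - i) z = theta k i z := by
  have h2 := (Equiv.neg ℤ).hasSum_iff.mpr (hasSum_theta k (2 * k + 1 - i) z)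
  refine (h2.congr_fun fun n => ?_).unique (hasSum_theta k i z)
  have hexp : cexp (Real.pi * I * ((-n : ℤ) : ℂ)) = cexp (Real.pi * I * n) := by
    rw [mul_comm _ ((-n : ℤ) : ℂ), mul_comm _ (n : ℂ), Complex.exp_int_mul,
      Complex.exp_int_mul, Complex.exp_pi_mul_I, zpow_neg]
    rcases Int.even_or_odd n with h | h <;> simp [h.neg_one_zpow]
  rw [Function.comp_apply, Equiv.neg_apply, Complex.exp_add, Complex.exp_add, hexp]
  congr 2
  push_cast [Nat.cast_sub hi]
  ring

/-- The coefficients of the transformation of the theta series under `z ↦ -1/z`. -/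
def thetaCoeff (k i j : ℕ) : ℂ :=
  cexp (Real.pi * I * (2 * i - (2 * k + 1)) * (2 * j - (2 * k + 1)) / (2 * (2 * k + 1)))

/-- Poisson summation, in the form of the functional equation of the two-variable theta function,
followed by splitting the sum into residue classes modulo `2k+1`. -/
theorem theta_S_smul_aux (k i : ℕ) (z : ℍ) :
    theta k i (ModularGroup.S • z) =
      1 / ((2 * k + 1 : ℝ) * (I / z) : ℂ) ^ (1 / 2 : ℂ) *
        ∑ j : Fin (2 * k + 1), thetaCoeff k i j * theta k j z := by
  have hm : (2 * k + 1 : ℂ) ≠ 0 := by exact_mod_cast Nat.succ_ne_zero (2 * k)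
  have hz : (z : ℂ) ≠ 0 := z.ne_zero
  have hτ : 0 < ((z : ℂ) / (2 * k + 1)).im := by
    have h : ((z : ℂ) / (2 * k + 1)).im = z.im / (2 * k + 1) := by
      rw [show (2 * k + 1 : ℂ) = ((2 * k + 1 : ℝ) : ℂ) by push_cast; rfl, Complex.div_ofReal_im]; rfl
    rw [h]
    have := z.im_pos
    positivity
  -- the transformed series, as a sum over the odd integers `2n - (2k+1)`
  set f : ℤ → ℂ := fun n => cexp (Real.pi * I * (2 * i - (2 * k + 1)) * (2 * n - (2 * k + 1)) /
    (2 * (2 * k + 1)) + Real.pi * I * z * (2 * n - (2 * k + 1)) ^ 2 / (4 * (2 * k + 1))) with hf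
  set C : ℂ := 1 / ((2 * k + 1 : ℝ) * (I / z) : ℂ) ^ (1 / 2 : ℂ) with hC
  have h1 : HasSum (fun n => C * f n) (theta k i (ModularGroup.S • z)) := by
    rw [theta, coe_S_smul, jacobiTheta₂_functional_equation]
    have e1 : -I * ((2 * k + 1) * (-1 / z) : ℂ) = ((2 * k + 1 : ℝ) * (I / z) : ℂ) := by
      push_cast; ring
    have e2 : (-1 / ((2 * k + 1) * (-1 / z)) : ℂ) = z / (2 * k + 1) := by field_simp
    rw [e1, e2, ← hC]
    have h2 := (hasSum_jacobiTheta₂_term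
      ((i * (-1 / z) + 1 / 2 - (2 * k + 1) * (-1 / z) / 2) / ((2 * k + 1) * (-1 / z)) : ℂ) hτ)
    rw [← (Equiv.subRight (k : ℤ)).hasSum_iff] at h2
    rw [mul_assoc, mul_left_comm, ← mul_assoc (qPow _ _)]
    refine ((h2.mul_left _).mul_left C).congr_fun fun n => ?_
    rw [Function.comp_apply, jacobiTheta₂_term, qPow, coe_S_smul, ← Complex.exp_add,
      ← Complex.exp_add, hf]
    simp only [thetaExponent, Equiv.subRight_apply]
    congr 2
    push_cast
    field_simp
    ring
  rw [← (Int.divModEquiv (2 * k + 1)).symm.hasSum_iff,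
    ← (Equiv.prodComm (Fin (2 * k + 1)) ℤ).hasSum_iff] at h1
  have h2 : HasSum (fun j : Fin (2 * k + 1) => C * (thetaCoeff k i j * theta k j z))
      (theta k i (ModularGroup.S • z)) := by
    refine HasSum.prod_fiberwise h1 fun j => ?_
    refine (((hasSum_theta k j z).mul_left _).mul_left C).congr_fun fun l => ?_
    simp only [Function.comp_apply, Equiv.prodComm_apply, Prod.swap_prod_mk,
      Int.divModEquiv_symm_apply, hf, thetaCoeff]
    rw [← Complex.exp_add]
    congr 1
    refine Complex.exp_eq_exp_iff_exists_int.mpr ⟨(i - k - 1) * l, ?_⟩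
    push_cast
    field_simp
    ring
  rw [Finset.mul_sum]
  exact h2.unique (hasSum_fintype _)

theorem exists_theta_S_smul (k i : ℕ) : ∃ s : Fin k → ℂ, ∀ z : ℍ,
    theta k i (ModularGroup.S • z) = 1 / ((2 * k + 1 : ℝ) * (I / z) : ℂ) ^ (1 / 2 : ℂ) *
      ∑ j : Fin k, s j * theta k (j + 1) z := by
  refine ⟨fun j => thetaCoeff k i (j + 1) + thetaCoeff k i (2 * k - j), fun z => ?_⟩
  rw [theta_S_smul_aux]
  congr 1
  rw [Fin.sum_univ_eq_sum_range (fun j => thetaCoeff k i j * theta k j z),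
    Fin.sum_univ_eq_sum_range (fun j => (thetaCoeff k i (j + 1) + thetaCoeff k i (2 * k - j)) *
      theta k (j + 1) z), Finset.sum_range_succ', theta_zero, mul_zero, add_zero, two_mul,
    Finset.sum_range_add, ← Finset.sum_range_reflect (fun x => thetaCoeff k i (k + x + 1) * _),
    ← Finset.sum_add_distrib]
  refine Finset.sum_congr rfl fun j hj => ?_
  have hj := Finset.mem_range.mp hj
  rw [show k + (k - 1 - j) + 1 = 2 * k + 1 - (j + 1) by omega, theta_sub k (by omega),
    show k + k - j = 2 * k + 1 - (j + 1) by omega, add_mul]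

theorem real_mul_cpow {a : ℝ} (ha : 0 < a) {w : ℂ} (hw : w ≠ 0) (c : ℂ) :
    ((a : ℂ) * w) ^ c = (a : ℂ) ^ c * w ^ c := by
  have ha' : (a : ℂ) ≠ 0 := by exact_mod_cast ha.ne'
  rw [cpow_def_of_ne_zero (mul_ne_zero ha' hw), cpow_def_of_ne_zero ha', cpow_def_of_ne_zero hw,
    Complex.log_ofReal_mul ha hw, ← Complex.exp_add, ← add_mul, Complex.ofReal_log ha.le]

/-- The span of the characters is stable under `z ↦ -1/z`: the automorphy factors of the theta
series and of the eta function cancel. -/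
theorem exists_characters_S_smul (k : ℕ) : ∃ s : Fin k → Fin k → ℂ, ∀ i, ∀ z : ℍ,
    characters k i (ModularGroup.S • z) = ∑ j, s i j * characters k j z := by
  choose s hs using exists_theta_S_smul k
  obtain ⟨t, ht⟩ := exists_theta_S_smul 1 1
  have ha : (0 : ℝ) < 2 * k + 1 := by positivity
  have hb : (0 : ℝ) < 2 * (1 : ℕ) + 1 := by positivity
  set a : ℂ := ((2 * k + 1 : ℝ) : ℂ) ^ (1 / 2 : ℂ) with hadef
  set b : ℂ := ((2 * (1 : ℕ) + 1 : ℝ) : ℂ) ^ (1 / 2 : ℂ) with hbdef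
  have ha0 : a ≠ 0 := by
    rw [hadef, Ne, cpow_eq_zero_iff]
    exact fun h => ha.ne' (by exact_mod_cast h.1)
  have hb0 : b ≠ 0 := by
    rw [hbdef, Ne, cpow_eq_zero_iff]
    exact fun h => hb.ne' (by exact_mod_cast h.1)
  refine ⟨fun i j => b / (a * t 0) * s (i + 1) j, fun i z => ?_⟩
  have hw : I / (z : ℂ) ≠ 0 := div_ne_zero I_ne_zero z.ne_zero
  have hw0 : (I / (z : ℂ)) ^ (1 / 2 : ℂ) ≠ 0 := by
    rw [Ne, cpow_eq_zero_iff]; exact fun h => hw h.1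
  have heta := ht z
  simp only [Finset.univ_unique, Fin.default_eq_zero, Finset.sum_singleton, Fin.val_zero, zero_add,
    theta_one_one] at heta
  have htheta := hs (i + 1) z
  rw [real_mul_cpow ha hw, ← hadef] at htheta
  rw [real_mul_cpow hb hw, ← hbdef] at heta
  have hη := eta_ne_zero z
  have ht0 : t 0 ≠ 0 := by
    intro h
    rw [h] at heta
    exact eta_ne_zero (ModularGroup.S • z) (by rw [heta]; ring)
  have hch (j : Fin k) : characters k j z = theta k (j + 1) z / ModularForm.eta z := by
    rw [characters, character_eq_div (by omega) (by omega)]; rfl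
  simp only [hch]
  rw [characters, character_eq_div (by omega) (by omega), Pi.div_apply, htheta, heta]
  simp only [mul_assoc, ← Finset.mul_sum, ← mul_div_assoc, ← Finset.sum_div]
  field_simp

open ModularForm EisensteinSeries

/-! ### Modular forms with rational Fourier coefficients -/

theorem HasQExp.of_X_mul {r : ℚ} {p : PowerSeries ℚ} {f : ℍ → ℂ}
    (h : HasQExp r (PowerSeries.X * p) f) : HasQExp (r + 1) p f := by
  intro z
  have h1 := h z
  rw [← hasSum_nat_add_iff' 1] at h1
  simp only [Finset.range_one, Finset.sum_singleton, PowerSeries.coeff_zero_X_mul, Rat.cast_zero,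
    zero_mul, sub_zero] at h1
  refine h1.congr_fun fun n => ?_
  rw [PowerSeries.coeff_succ_X_mul]
  push_cast
  rw [add_assoc, add_comm 1 (n : ℚ)]

theorem exists_hasQExp_discriminant :
    ∃ p : PowerSeries ℚ, p.constantCoeff = 1 ∧ HasQExp 1 p discriminant := by
  obtain ⟨p, hp1, hp⟩ := exists_hasQExp_eta
  refine ⟨p ^ 24, by simp [hp1], ?_⟩
  have := hp.pow 24
  norm_num at this
  exact this

theorem exists_hasQExp_E2 : ∃ p : PowerSeries ℚ, HasQExp 0 p E2 := by
  refine ⟨PowerSeries.mk fun m =>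
    if m = 0 then 1 else -24 * (ArithmeticFunction.sigma 1 m : ℚ), fun z => ?_⟩
  refine (hasSum_qExpansion_E2 (z := z)).congr_fun fun m => ?_
  rw [PowerSeries.coeff_mk, zero_add, qPow_natCast, smul_eq_mul]
  congr 1
  · split_ifs <;> push_cast <;> rfl
  · simp [qPow]

theorem exists_hasQExp_E {k : ℕ} (hk : 3 ≤ k) (hk2 : Even k) :
    ∃ p : PowerSeries ℚ, p.constantCoeff = 1 ∧ HasQExp 0 p (E hk) := by
  refine ⟨PowerSeries.mk fun m => if m = 0 then 1 else
    -(2 * k / bernoulli k : ℚ) * (ArithmeticFunction.sigma (k - 1) m : ℚ), by simp, ?_⟩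
  refine HasQExp.of_qExpansion _ ?_
  ext m
  rw [E_qExpansion_coeff hk hk2, PowerSeries.coeff_map, PowerSeries.coeff_mk]
  split_ifs
  · simp
  · simp

/-- A level one modular form with rational Fourier coefficients is a polynomial in `E₄` and `E₆` with
rational coefficients. -/
theorem mem_adjoin_of_hasQExp {w : ℤ} (f : ModularForm 𝒮ℒ w) {p : PowerSeries ℚ}
    (hf : HasQExp 0 p f) : (f : ℍ → ℂ) ∈ Algebra.adjoin ℚ ({⇑E₄, ⇑E₆} : Set (ℍ → ℂ)) := by
  -- induction on the weight, in steps of the weight `12` of the discriminant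
  suffices H : ∀ n : ℕ, ∀ w : ℤ, w < 12 * n → ∀ f : ModularForm 𝒮ℒ w, ∀ p : PowerSeries ℚ,
      HasQExp 0 p f → (f : ℍ → ℂ) ∈ Algebra.adjoin ℚ ({⇑E₄, ⇑E₆} : Set (ℍ → ℂ)) from
    H (w.toNat + 1) w (by omega) f p hf
  have hE4 : (⇑E₄ : ℍ → ℂ) ∈ Algebra.adjoin ℚ ({⇑E₄, ⇑E₆} : Set (ℍ → ℂ)) :=
    Algebra.subset_adjoin (by simp)
  have hE6 : (⇑E₆ : ℍ → ℂ) ∈ Algebra.adjoin ℚ ({⇑E₄, ⇑E₆} : Set (ℍ → ℂ)) :=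
    Algebra.subset_adjoin (by simp)
  have hΔ : (discriminant : ℍ → ℂ) ∈ Algebra.adjoin ℚ ({⇑E₄, ⇑E₆} : Set (ℍ → ℂ)) := by
    have : (discriminant : ℍ → ℂ) = (1 / 1728 : ℚ) • ((⇑E₄ : ℍ → ℂ) ^ 3 - (⇑E₆ : ℍ → ℂ) ^ 2) := by
      funext z
      rw [discriminant_eq_E₄_cube_sub_E₆_sq]
      simp [Rat.smul_def]
      ring
    rw [this]
    exact Subalgebra.smul_mem _ (sub_mem (pow_mem hE4 3) (pow_mem hE6 2)) _
  intro n
  induction n with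
  | zero =>
    intro w hw f p _
    rw [ModularFormClass.levelOne_neg_weight_eq_zero (by simpa using hw) f]
    exact zero_mem _
  | succ n ih =>
    intro w hw f p hf
    rcases lt_or_ge w 0 with hneg | hnonneg
    · rw [ModularFormClass.levelOne_neg_weight_eq_zero hneg f]
      exact zero_mem _
    rcases Int.even_or_odd w with heven | hodd
    swap
    · rw [ModularForm.levelOne_odd_weight_eq_zero hodd f]
      exact zero_mem _
    rcases eq_or_ne w 2 with rfl | h2
    · rw [rank_zero_iff_forall_zero.mp levelOne_weight_two_rank_zero f]
      exact zero_mem _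
    obtain ⟨a, b, hab⟩ : ∃ a b : ℕ, (a : ℤ) * 4 + (b : ℤ) * 6 = w := by
      obtain ⟨t, rfl⟩ := heven
      rcases Int.even_or_odd t with ⟨s, rfl⟩ | ⟨s, rfl⟩
      · exact ⟨s.toNat, 0, by omega⟩
      · exact ⟨(s - 1).toNat, 1, by omega⟩
    obtain ⟨p4, hp4, h4⟩ := exists_hasQExp_E (k := 4) (by norm_num) ⟨2, rfl⟩
    obtain ⟨p6, hp6, h6⟩ := exists_hasQExp_E (k := 6) (by norm_num) ⟨3, rfl⟩
    have hg := (h4.pow a).mul (h6.pow b)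
    simp only [mul_zero, add_zero] at hg
    set g : ModularForm 𝒮ℒ w := ModularForm.mcast hab ((E₄.pow a).mul (E₆.pow b)) with hgdef
    have hgcoe : (g : ℍ → ℂ) = (⇑E₄ : ℍ → ℂ) ^ a * (⇑E₆ : ℍ → ℂ) ^ b := by
      funext z; simp [hgdef]
    rw [← hgcoe] at hg
    set c := p.constantCoeff with hc
    set h : ModularForm 𝒮ℒ w := f - (c : ℂ) • g with hh
    have hhq : HasQExp 0 (p - c • (p4 ^ a * p6 ^ b)) h := hf.sub (hg.smul c)
    have h0 : (p - c • (p4 ^ a * p6 ^ b)).constantCoeff = 0 := by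
      rw [map_sub, PowerSeries.constantCoeff_smul]
      simp [hp4, hp6, hc]
    obtain ⟨p', hp'⟩ := PowerSeries.X_dvd_iff.mpr h0
    have hcusp : (UpperHalfPlane.qExpansion 1 h).coeff 0 = 0 := by
      rw [HasQExp.qExpansion_eq h hhq, PowerSeries.coeff_map, PowerSeries.coeff_zero_eq_constantCoeff,
        h0, map_zero]
    -- `f` minus a multiple of `E₄^a E₆^b` is a cusp form, and `Δ` divides it
    obtain ⟨δ, hδ1, hδ⟩ := exists_hasQExp_discriminant
    have hquot := hhq.div hδ (by simp [hδ1]) discriminant_ne_zero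
    rw [hp', mul_assoc] at hquot
    have hquot' := hquot.of_X_mul
    rw [zero_sub, neg_add_cancel] at hquot'
    have key := ih (w - 12) (by push_cast at hw; omega)
      (CuspForm.discriminantEquiv (toCuspForm h hcusp)) _ hquot'
    have hh2 : (h : ℍ → ℂ) =
        discriminant * ⇑(CuspForm.discriminantEquiv (toCuspForm h hcusp)) :=
      (discriminant_mul_discriminantEquiv (toCuspForm h hcusp)).symm
    have hf2 : (f : ℍ → ℂ) = h + c • (g : ℍ → ℂ) := by
      funext z; simp [hh, Rat.smul_def]
    rw [hf2, hh2, hgcoe]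
    exact add_mem (mul_mem hΔ key)
      (Subalgebra.smul_mem _ (mul_mem (pow_mem hE4 a) (pow_mem hE6 b)) _)

/-! ### Quasimodular forms -/

/-- The ring `ℚ[E₂, E₄, E₆]`. -/
abbrev quasiModularRing : Subalgebra ℚ (ℍ → ℂ) := Algebra.adjoin ℚ ({E2, ⇑E₄, ⇑E₆} : Set (ℍ → ℂ))

theorem mem_quasiModularRing_of_hasQExp {w : ℤ} (f : ModularForm 𝒮ℒ w) {p : PowerSeries ℚ}
    (hf : HasQExp 0 p f) : (f : ℍ → ℂ) ∈ quasiModularRing :=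
  Algebra.adjoin_mono (by intro x; simp; tauto) (mem_adjoin_of_hasQExp f hf)

theorem HasQExp.mem_quasiModularRing {p : PowerSeries ℚ} {f : ℍ → ℂ} (hf : HasQExp 0 p f) {k : ℤ}
    (hS : f ∣[k] ModularGroup.S = f) : f ∈ quasiModularRing := by
  obtain ⟨F, rfl⟩ := hf.exists_modularForm hS
  exact mem_quasiModularRing_of_hasQExp F hf

theorem E2_mem : E2 ∈ quasiModularRing := Algebra.subset_adjoin (by simp)

theorem deriv_eisenstein_mem {k : ℕ} (hk : 3 ≤ k) (hk2 : Even k)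
    (hmem : (E hk : ℍ → ℂ) ∈ quasiModularRing) : D (E hk : ℍ → ℂ) ∈ quasiModularRing := by
  obtain ⟨p, -, hp⟩ := exists_hasQExp_E hk hk2
  obtain ⟨e, he⟩ := exists_hasQExp_E2
  have hs : Derivative.serreDerivative (k : ℤ) (E hk) =
      D (E hk : ℍ → ℂ) - (((k : ℚ) * 12⁻¹ : ℚ) : ℂ) • (E2 * (E hk : ℍ → ℂ)) := by
    funext z; simp [Derivative.serreDerivative]; ring
  have hmul := he.mul hp
  rw [add_zero] at hmul
  have hq := hp.deriv.sub (hmul.smul ((k : ℚ) * 12⁻¹))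
  rw [← hs] at hq
  have hm := hq.mem_quasiModularRing (k := (k : ℤ) + 2)
    (Derivative.serreDerivative_slash_invariant hp.mdiff
      ((E hk).slash_action_eq' _ ⟨ModularGroup.S, rfl⟩))
  have h1 : D (E hk : ℍ → ℂ) = Derivative.serreDerivative (k : ℤ) (E hk) +
      ((k : ℚ) * 12⁻¹ : ℚ) • (E2 * (E hk : ℍ → ℂ)) := by
    rw [hs]; funext z; simp [Rat.smul_def]
  rw [h1]
  exact add_mem hm (Subalgebra.smul_mem _ (mul_mem E2_mem hmem) _)

/-- Ramanujan: `D E₂ - E₂² / 12` transforms like a modular form of weight `4`. -/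
theorem deriv_E2_sub_slash_S :
    (D E2 - (((12⁻¹ : ℚ) : ℂ) • (E2 * E2))) ∣[(4 : ℤ)] ModularGroup.S =
      D E2 - (((12⁻¹ : ℚ) : ℂ) • (E2 * E2)) := by
  have hE2 : E2 ∣[(2 : ℤ)] ModularGroup.S = E2 - fun z : ℍ => 6 * I / Real.pi * (z : ℂ)⁻¹ := by
    rw [E2_slash_action]
    funext z
    have hπ : (Real.pi : ℂ) ≠ 0 := by exact_mod_cast Real.pi_ne_zero
    simp only [Pi.sub_apply, Pi.smul_apply, smul_eq_mul, D2_S, riemannZeta_two]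
    field_simp
  have hinv (z : ℍ) : HasDerivAt ((fun z : ℍ => 6 * I / Real.pi * (z : ℂ)⁻¹) ∘ ofComplex)
      (6 * I / Real.pi * -((z : ℂ) ^ 2)⁻¹) z := by
    refine ((hasDerivAt_inv z.ne_zero).const_mul _).congr_of_eventuallyEq ?_
    filter_upwards [isOpen_upperHalfPlaneSet.mem_nhds z.2] with w hw
    simp [Function.comp_apply, ofComplex_apply_of_im_pos hw]
  have hinvM : MDiff (fun z : ℍ => 6 * I / Real.pi * (z : ℂ)⁻¹) := fun z =>
    UpperHalfPlane.mdifferentiableAt_iff.mpr (hinv z).differentiableAt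
  have h1 := Derivative.normalizedDerivOfComplex_SL_slash (k := 2) E2_mdifferentiable
    (γ := ModularGroup.S)
  rw [hE2, Derivative.normalizedDerivOfComplex_sub _ _ E2_mdifferentiable hinvM] at h1
  funext z
  have h2 := congrFun h1 z
  have h3 : D (fun z : ℍ => 6 * I / Real.pi * (z : ℂ)⁻¹) z =
      (2 * Real.pi * I)⁻¹ * (6 * I / Real.pi * -((z : ℂ) ^ 2)⁻¹) := by
    rw [Derivative.normalizedDerivOfComplex, (hinv z).deriv]
  have h4 : ((E2 * E2) ∣[(4 : ℤ)] ModularGroup.S) z =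
      (E2 z - 6 * I / Real.pi * (z : ℂ)⁻¹) * (E2 z - 6 * I / Real.pi * (z : ℂ)⁻¹) := by
    have := congrFun (ModularForm.mul_slash_SL2 2 2 ModularGroup.S E2 E2) z
    rw [hE2] at this
    exact this
  have h5 : (D E2 ∣[(4 : ℤ)] ModularGroup.S) z = D E2 z -
      (2 * Real.pi * I)⁻¹ * (6 * I / Real.pi * -((z : ℂ) ^ 2)⁻¹) +
      2 * (2 * Real.pi * I)⁻¹ * (z : ℂ)⁻¹ * (E2 z - 6 * I / Real.pi * (z : ℂ)⁻¹) := by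
    have h6 : D E2 z - D (fun z : ℍ => 6 * I / Real.pi * (z : ℂ)⁻¹) z =
        (D E2 ∣[(4 : ℤ)] ModularGroup.S) z - 2 * (2 * Real.pi * I)⁻¹ * (1 / z) *
          (E2 z - 6 * I / Real.pi * (z : ℂ)⁻¹) := by
      have hd : denom (Matrix.SpecialLinearGroup.toGL ((Matrix.SpecialLinearGroup.map
        (Int.castRingHom ℝ)) ModularGroup.S)) (z : ℂ) = z := ModularGroup.denom_S z
      have hc : ((ModularGroup.S 1 0 : ℤ) : ℂ) = 1 := by simp [ModularGroup.S]
      simp only [Pi.sub_apply] at h2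
      rw [hd, hc] at h2
      exact_mod_cast h2
    rw [h3] at h6
    linear_combination -h6
  rw [sub_eq_add_neg, ← _root_.neg_smul, SlashAction.add_slash, ModularForm.SL_smul_slash, Pi.add_apply,
    Pi.smul_apply, h4, h5]
  simp only [Pi.add_apply, Pi.smul_apply, Pi.mul_apply, smul_eq_mul]
  have hπ : (Real.pi : ℂ) ≠ 0 := by exact_mod_cast Real.pi_ne_zero
  have hz := z.ne_zero
  push_cast
  field_simp
  linear_combination (24 * Real.pi * z * E2 z - 72 * I) * I_sq

theorem deriv_E2_mem : D E2 ∈ quasiModularRing := by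
  obtain ⟨e, he⟩ := exists_hasQExp_E2
  have hmul := he.mul he
  rw [add_zero] at hmul
  have hq := he.deriv.sub (hmul.smul 12⁻¹)
  have hm := hq.mem_quasiModularRing deriv_E2_sub_slash_S
  have h1 : D E2 = (D E2 - (((12⁻¹ : ℚ) : ℂ) • (E2 * E2))) + (12⁻¹ : ℚ) • (E2 * E2) := by
    funext z; simp [Rat.smul_def]
  rw [h1]
  exact add_mem hm (Subalgebra.smul_mem _ (mul_mem E2_mem E2_mem) _)

/-- The ring `ℚ[E₂, E₄, E₆]` consists of holomorphic functions and is stable under `D`. -/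
theorem mdiff_and_deriv_mem {f : ℍ → ℂ} (hf : f ∈ quasiModularRing) :
    MDiff f ∧ D f ∈ quasiModularRing := by
  induction hf using Algebra.adjoin_induction with
  | mem f hf =>
    obtain ⟨p4, -, h4⟩ := exists_hasQExp_E (k := 4) (by norm_num) ⟨2, rfl⟩
    obtain ⟨p6, -, h6⟩ := exists_hasQExp_E (k := 6) (by norm_num) ⟨3, rfl⟩
    rcases hf with rfl | rfl | rfl
    · exact ⟨E2_mdifferentiable, deriv_E2_mem⟩
    · exact ⟨h4.mdiff, deriv_eisenstein_mem _ ⟨2, rfl⟩ (Algebra.subset_adjoin (by simp))⟩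
    · exact ⟨h6.mdiff, deriv_eisenstein_mem _ ⟨3, rfl⟩ (Algebra.subset_adjoin (by simp))⟩
  | algebraMap r =>
    have h : algebraMap ℚ (ℍ → ℂ) r = fun _ => (r : ℂ) := by funext z; simp
    rw [h, Derivative.normalizedDerivOfComplex_const]
    exact ⟨mdifferentiable_const, zero_mem _⟩
  | add f g hf hg h1 h2 =>
    rw [Derivative.normalizedDerivOfComplex_add f g h1.1 h2.1]
    exact ⟨h1.1.add h2.1, add_mem h1.2 h2.2⟩
  | mul f g hf hg h1 h2 =>
    rw [Derivative.normalizedDerivOfComplex_mul f g h1.1 h2.1]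
    exact ⟨h1.1.mul h2.1, add_mem (mul_mem h1.2 hg) (mul_mem hf h2.2)⟩

/-! ### Linear differential equations on the upper half-plane -/

theorem mdiff_iterate_deriv {y : ℍ → ℂ} (hy : MDiff y) (r : ℕ) : MDiff (D^[r] y) := by
  induction r with
  | zero => exact hy
  | succ r ih =>
    rw [Function.iterate_succ_apply']
    exact Derivative.normalizedDerivOfComplex_mdifferentiable ih

theorem mdiff_sum {ι : Type*} (t : Finset ι) {f : ι → ℍ → ℂ} (hf : ∀ i ∈ t, MDiff (f i)) :
    MDiff (∑ i ∈ t, f i) := by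
  classical
  induction t using Finset.induction_on with
  | empty => exact (mdifferentiable_const : MDiff (fun _ : ℍ => (0 : ℂ)))
  | insert a t ha ih =>
    rw [Finset.sum_insert ha]
    exact (hf a (by simp)).add (ih fun i hi => hf i (by simp [hi]))

theorem mdiff_prod {ι : Type*} (t : Finset ι) {f : ι → ℍ → ℂ} (hf : ∀ i ∈ t, MDiff (f i)) :
    MDiff (∏ i ∈ t, f i) := by
  classical
  induction t using Finset.induction_on with
  | empty => exact (mdifferentiable_const : MDiff (fun _ : ℍ => (1 : ℂ)))
  | insert a t ha ih =>
    rw [Finset.prod_insert ha]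
    exact (hf a (by simp)).mul (ih fun i hi => hf i (by simp [hi]))

theorem mdiff_smul (c : ℂ) {f : ℍ → ℂ} (hf : MDiff f) : MDiff (c • f) :=
  (mdifferentiable_const : MDiff (fun _ : ℍ => c)).mul hf

theorem mdiff_det {n : ℕ} {f : Fin n → Fin n → ℍ → ℂ} (hf : ∀ i j, MDiff (f i j)) :
    MDiff (fun z => (Matrix.of fun i j => f i j z).det) := by
  have e : (fun z => (Matrix.of fun i j => f i j z).det) =
      ∑ σ : Equiv.Perm (Fin n), ((Equiv.Perm.sign σ : ℤ) : ℂ) • ∏ i, f (σ i) i := by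
    funext z
    rw [Matrix.det_apply, Finset.sum_apply]
    refine Finset.sum_congr rfl fun σ _ => ?_
    simp [Units.smul_def]
  rw [e]
  exact mdiff_sum _ fun σ _ => mdiff_smul _ (mdiff_prod _ fun i _ => hf _ _)

theorem mdiff_div {f g : ℍ → ℂ} (hf : MDiff f) (hg : MDiff g) (h0 : ∀ z, g z ≠ 0) :
    MDiff (f / g) := by
  rw [UpperHalfPlane.mdifferentiable_iff] at hf hg ⊢
  exact hf.div hg fun z _ => h0 _

theorem deriv_sum {ι : Type*} (t : Finset ι) {f : ι → ℍ → ℂ} (hf : ∀ i ∈ t, MDiff (f i)) :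
    D (∑ i ∈ t, f i) = ∑ i ∈ t, D (f i) := by
  classical
  induction t using Finset.induction_on with
  | empty => exact Derivative.normalizedDerivOfComplex_const 0
  | insert a t ha ih =>
    rw [Finset.sum_insert ha, Finset.sum_insert ha, Derivative.normalizedDerivOfComplex_add _ _
      (hf a (by simp)) (mdiff_sum _ fun i hi => hf i (by simp [hi])),
      ih fun i hi => hf i (by simp [hi])]

theorem iterate_deriv_sum_smul {ι : Type*} [Fintype ι] {f : ι → ℍ → ℂ} (hf : ∀ i, MDiff (f i))
    (c : ι → ℂ) (r : ℕ) : D^[r] (∑ i, c i • f i) = ∑ i, c i • D^[r] (f i) := by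
  induction r with
  | zero => rfl
  | succ r ih =>
    rw [Function.iterate_succ_apply', ih, deriv_sum _ fun i _ =>
      mdiff_smul _ (mdiff_iterate_deriv (hf i) r)]
    refine Finset.sum_congr rfl fun i _ => ?_
    rw [Derivative.normalizedDerivOfComplex_smul _ _ (mdiff_iterate_deriv (hf i) r),
      Function.iterate_succ_apply']

theorem exists_eq_const_of_deriv_eq_zero {f : ℍ → ℂ} (hf : MDiff f) (h0 : D f = 0) :
    ∃ c, ∀ z, f z = c := by
  rw [UpperHalfPlane.mdifferentiable_iff] at hf
  obtain ⟨c, hc⟩ := isOpen_upperHalfPlaneSet.exists_is_const_of_deriv_eq_zero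
    (convex_halfSpace_im_gt 0).isPreconnected hf (fun z hz => by
      have h1 := congrFun h0 ⟨z, hz⟩
      rw [Derivative.normalizedDerivOfComplex] at h1
      simpa [Real.pi_ne_zero] using h1)
  exact ⟨c, fun z => by simpa using hc z z.2⟩

theorem wronskian_zero_apply {k : ℕ} (f : Fin k → ℍ → ℂ) (z : ℍ) :
    wronskian 0 f z = (Matrix.of fun r c : Fin k => D^[r.val] (f c) z).det := rfl

theorem monicOp_apply {k : ℕ} (P : Fin k → ℍ → ℂ) (y : ℍ → ℂ) (z : ℍ) :
    monicOp P y z = D^[k] y z + ∑ i, P i z * D^[i.val] y z := by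
  simp [monicOp]

theorem monicOp_sum_smul {k : ℕ} (P : Fin k → ℍ → ℂ) {ι : Type*} [Fintype ι] {f : ι → ℍ → ℂ}
    (hf : ∀ i, MDiff (f i)) (c : ι → ℂ) :
    monicOp P (∑ i, c i • f i) = ∑ i, c i • monicOp P (f i) := by
  funext z
  simp only [monicOp_apply, iterate_deriv_sum_smul hf, Finset.sum_apply, Pi.smul_apply, smul_eq_mul,
    mul_add, Finset.sum_add_distrib, Finset.mul_sum]
  rw [Finset.sum_comm]
  simp only [mul_left_comm]

/-- The coefficients of a monic equation are determined by solutions with nonvanishing Wronskian. -/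
theorem eq_of_monicOp_eq_zero {k : ℕ} {P P' : Fin k → ℍ → ℂ} {f : Fin k → ℍ → ℂ}
    (hw : ∀ z, wronskian 0 f z ≠ 0) (hP : ∀ j, monicOp P (f j) = 0)
    (hP' : ∀ j, monicOp P' (f j) = 0) : P' = P := by
  funext i z
  have h := Matrix.eq_zero_of_vecMul_eq_zero (hw z) (v := fun i => P' i z - P i z) (by
    funext j
    have h1 := congrFun (hP j) z
    have h2 := congrFun (hP' j) z
    rw [monicOp_apply, Pi.zero_apply] at h1 h2
    simp only [Matrix.vecMul, dotProduct, Matrix.of_apply, sub_mul, Finset.sum_sub_distrib,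
      Pi.zero_apply]
    simp only [add_zero]
    linear_combination h2 - h1)
  exact sub_eq_zero.mp (congrFun h i)

/-- Variation of constants: solutions with nonvanishing Wronskian span all solutions. -/
theorem isFundamentalSystem_of_wronskian_ne_zero {k : ℕ} {P f : Fin k → ℍ → ℂ}
    (hf : ∀ j, MDiff (f j)) (hw : ∀ z, wronskian 0 f z ≠ 0) (hP : ∀ j, monicOp P (f j) = 0) :
    IsFundamentalSystem P f := by
  refine ⟨?_, fun y => ⟨fun hy => ?_, fun ⟨hy, hPy⟩ => ?_⟩⟩
  · rw [Fintype.linearIndependent_iff]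
    intro c hc i
    have h := Matrix.eq_zero_of_mulVec_eq_zero (hw UpperHalfPlane.I) (v := c) (by
      funext r
      have h1 : D^[r.val] (∑ j, c j • f j) UpperHalfPlane.I = 0 := by
        have h2 := iterate_deriv_sum_smul (ι := Fin k) (f := fun _ => 0)
          (fun _ => (mdifferentiable_const : MDiff (fun _ : ℍ => (0 : ℂ)))) 0 r
        simp only [Pi.zero_apply, zero_smul, Finset.sum_const_zero] at h2
        rw [hc, h2]
        rfl
      rw [iterate_deriv_sum_smul hf] at h1
      simpa [Matrix.mulVec, dotProduct, mul_comm] using h1)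
    exact congrFun h i
  · obtain ⟨c, rfl⟩ := (Submodule.mem_span_range_iff_exists_fun ℂ).mp hy
    exact ⟨mdiff_sum _ fun i _ => mdiff_smul _ (hf i), by simp [monicOp_sum_smul P hf, hP]⟩
  · -- Cramer's rule gives holomorphic `u` with `∑ c, u c * D^r (f c) = D^r y` for `r < k`
    set A : ℍ → Matrix (Fin k) (Fin k) ℂ := fun z => Matrix.of fun r c => D^[r.val] (f c) z with hA
    set b : ℍ → Fin k → ℂ := fun z r => D^[r.val] y z with hb
    set u : Fin k → ℍ → ℂ :=
      fun c => (fun z => (A z).cramer (b z) c) / wronskian 0 f with hu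
    have hum (c : Fin k) : MDiff (u c) := by
      refine mdiff_div ?_ (mdiff_det fun i j => mdiff_iterate_deriv (hf j) _) hw
      have : (fun z => (A z).cramer (b z) c) = fun z => (Matrix.of fun r j =>
          (if j = c then D^[r.val] y else D^[r.val] (f j)) z).det := by
        funext z
        rw [Matrix.cramer_apply]
        congr 1
        ext r j
        rw [Matrix.updateCol_apply]
        split_ifs with h <;> simp [A, b, h]
      rw [this]
      refine mdiff_det (f := fun r j => if j = c then D^[r.val] y else D^[r.val] (f j))
        fun r j => ?_
      split_ifs
      · exact mdiff_iterate_deriv hy _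
      · exact mdiff_iterate_deriv (hf j) _
    have hlt (r : Fin k) : ∑ c, u c * D^[r.val] (f c) = D^[r.val] y := by
      funext z
      have h1 := congrFun (Matrix.mulVec_cramer (A z) (b z)) r
      have h2 := hw z
      simp only [Matrix.mulVec, dotProduct, Pi.smul_apply, smul_eq_mul, hA, Matrix.of_apply] at h1
      rw [← wronskian_zero_apply] at h1
      simp only [Finset.sum_apply, Pi.mul_apply, hu, Pi.div_apply]
      rw [← mul_right_inj' h2, Finset.mul_sum, ← h1]
      refine Finset.sum_congr rfl fun c _ => ?_
      field_simp
      exact mul_comm _ _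
    -- the differential equation gives the same for `r = k`
    have hk : ∑ c, u c * D^[k] (f c) = D^[k] y := by
      funext z
      have h1 := congrFun hPy z
      rw [monicOp_apply, Pi.zero_apply] at h1
      have h2 (c : Fin k) : D^[k] (f c) z = -∑ i, P i z * D^[i.val] (f c) z := by
        have := congrFun (hP c) z
        rw [monicOp_apply, Pi.zero_apply] at this
        exact eq_neg_of_add_eq_zero_left this
      rw [eq_neg_of_add_eq_zero_left h1]
      simp only [Finset.sum_apply, Pi.mul_apply, h2, ← hlt, mul_neg, Finset.sum_neg_distrib,
        Finset.mul_sum]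
      rw [Finset.sum_comm]
      simp only [mul_left_comm]
    have hle (r : Fin k) : ∑ c, u c * D^[r.val + 1] (f c) = D^[r.val + 1] y := by
      rcases Nat.lt_or_ge (r.val + 1) k with h | h
      · exact hlt ⟨r.val + 1, h⟩
      · rw [show r.val + 1 = k by omega, hk]
    -- differentiating, the derivatives of `u` solve the homogeneous system
    have hDu (c : Fin k) : D (u c) = 0 := by
      funext z
      refine congrFun (Matrix.eq_zero_of_mulVec_eq_zero (hw z) (v := fun c => D (u c) z) ?_) c
      funext r
      have h1 := congrArg (fun g => D g z) (hlt r)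
      have h2 := congrFun (hle r) z
      rw [deriv_sum _ fun c _ => (hum c).mul (mdiff_iterate_deriv (hf c) _), Finset.sum_apply,
        ← Function.iterate_succ_apply' (f := D), ← h2, Finset.sum_apply] at h1
      simp only [Derivative.normalizedDerivOfComplex_mul _ _ (hum _)
        (mdiff_iterate_deriv (hf _) _), ← Function.iterate_succ_apply' (f := D), Pi.add_apply,
        Pi.mul_apply, Finset.sum_add_distrib] at h1
      simp only [Matrix.mulVec, dotProduct, Matrix.of_apply, Pi.zero_apply, add_zero]
      simpa [mul_comm] using h1
    choose c hc using fun i => exists_eq_const_of_deriv_eq_zero (hum i) (hDu i)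
    rcases Nat.eq_zero_or_pos k with rfl | hk0
    · have : y = 0 := by simpa using hk.symm
      rw [this]
      exact zero_mem _
    · have h1 := hlt ⟨0, hk0⟩
      refine (Submodule.mem_span_range_iff_exists_fun ℂ).mpr ⟨c, ?_⟩
      rw [← show D^[0] y = y from rfl]
      refine Eq.trans ?_ h1
      refine Finset.sum_congr rfl fun i _ => ?_
      funext z
      simp [hc]

/-- The Wronskian of the derivatives is the lowest coefficient times the Wronskian. -/
theorem wronskian_one {k : ℕ} (hk : 0 < k) {P f : Fin k → ℍ → ℂ} (hP : ∀ j, monicOp P (f j) = 0) :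
    wronskian 1 f = ((-1 : ℂ) ^ k) • (P ⟨0, hk⟩ * wronskian 0 f) := by
  obtain ⟨n, rfl⟩ := Nat.exists_eq_succ_of_ne_zero hk.ne'
  funext z
  set A : Matrix (Fin (n + 1)) (Fin (n + 1)) ℂ := Matrix.of fun r c => D^[r.val] (f c) z with hA
  -- the rows `1, …, n + 1`, permuted cyclically, are the rows `0, …, n` with row `0` replaced by the
  -- combination of the old rows that the equation prescribes for row `n + 1`
  have h1 : (Matrix.of fun r c : Fin (n + 1) => D^[r.val + 1] (f c) z) =
      (A.updateRow 0 (∑ i, (-P i z) • A i)).submatrix (finRotate (n + 1)) id := by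
    ext r c
    induction r using Fin.lastCases with
    | last =>
      have := congrFun (hP c) z
      rw [monicOp_apply, Pi.zero_apply] at this
      rw [Matrix.submatrix_apply, finRotate_last, Matrix.updateRow_self]
      simpa [hA] using eq_neg_of_add_eq_zero_left this
    | cast r =>
      rw [Matrix.submatrix_apply, finRotate_apply, Matrix.updateRow_ne (by
        rw [Fin.coeSucc_eq_succ]; exact Fin.succ_ne_zero r)]
      simp [hA]
  rw [wronskian, h1, Matrix.det_permute, Matrix.det_updateRow_sum, sign_finRotate]
  simp only [Pi.smul_apply, Pi.mul_apply, wronskian_zero_apply, smul_eq_mul, Nat.succ_eq_add_one,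
    pow_succ]
  push_cast
  simp only [hA]
  simp

/-! ### Serre derivatives -/

/-- The coefficient of `D^j y` in `Θ^i y`. -/
def serreCoeff : ℕ → ℕ → ℍ → ℂ
  | 0, 0 => 1
  | 0, _ + 1 => 0
  | i + 1, 0 => Derivative.serreDerivative (2 * (i : ℂ)) (serreCoeff i 0)
  | i + 1, j + 1 =>
    Derivative.serreDerivative (2 * (i : ℂ)) (serreCoeff i (j + 1)) + serreCoeff i j

theorem serreDerivative_zero (w : ℂ) : Derivative.serreDerivative w 0 = 0 := by
  have : D (0 : ℍ → ℂ) = 0 := Derivative.normalizedDerivOfComplex_const 0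
  funext z
  simp [Derivative.serreDerivative, this]

theorem serreDerivative_mem {f : ℍ → ℂ} (hf : f ∈ quasiModularRing) (i : ℕ) :
    Derivative.serreDerivative (2 * (i : ℂ)) f ∈ quasiModularRing := by
  have : Derivative.serreDerivative (2 * (i : ℂ)) f =
      D f - (2 * (i : ℚ) * 12⁻¹ : ℚ) • (E2 * f) := by
    funext z; simp [Derivative.serreDerivative, Rat.smul_def, mul_assoc]
  rw [this]
  exact sub_mem (mdiff_and_deriv_mem hf).2 (Subalgebra.smul_mem _ (mul_mem E2_mem hf) _)

theorem serreCoeff_mem (i j : ℕ) : serreCoeff i j ∈ quasiModularRing := by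
  induction i generalizing j with
  | zero =>
    cases j
    · exact one_mem _
    · exact zero_mem _
  | succ i ih =>
    cases j
    · exact serreDerivative_mem (ih 0) i
    · exact add_mem (serreDerivative_mem (ih _) i) (ih _)

/-- The coefficients of the `Θ^i` in terms of the `D^j` form a unipotent triangular matrix. -/
theorem serreCoeff_of_lt {i j : ℕ} (h : i < j) : serreCoeff i j = 0 := by
  induction i generalizing j with
  | zero => cases j with
    | zero => omega
    | succ j => rfl
  | succ i ih => cases j with
    | zero => omega
    | succ j =>
      rw [serreCoeff, ih (by omega), ih (by omega), serreDerivative_zero, add_zero]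

theorem serreCoeff_self (i : ℕ) : serreCoeff i i = 1 := by
  induction i with
  | zero => rfl
  | succ i ih =>
    rw [serreCoeff, ih, serreCoeff_of_lt (by omega), serreDerivative_zero, zero_add]

/-- `Θ^i` kills constants for `i ≥ 1`, since `Θ_0 = D`. -/
theorem serreCoeff_succ_zero (i : ℕ) : serreCoeff (i + 1) 0 = 0 := by
  induction i with
  | zero =>
    have : D (1 : ℍ → ℂ) = 0 := Derivative.normalizedDerivOfComplex_const 1
    funext z
    simp [serreCoeff, Derivative.serreDerivative, this]
  | succ i ih => rw [serreCoeff, ih, serreDerivative_zero]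

theorem mdiff_serreCoeff (i j : ℕ) : MDiff (serreCoeff i j) :=
  (mdiff_and_deriv_mem (serreCoeff_mem i j)).1

theorem serreIter_eq_sum {y : ℍ → ℂ} (hy : MDiff y) (i : ℕ) :
    serreIter i y = ∑ j ∈ Finset.range (i + 1), serreCoeff i j * D^[j] y := by
  induction i with
  | zero => simp [serreIter, serreCoeff]
  | succ i ih =>
    have hm (j : ℕ) : MDiff (serreCoeff i j * D^[j] y) :=
      (mdiff_serreCoeff i j).mul (mdiff_iterate_deriv hy j)
    have h1 : serreIter (i + 1) y = ∑ j ∈ Finset.range (i + 1),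
        (Derivative.serreDerivative (2 * (i : ℂ)) (serreCoeff i j) * D^[j] y +
          serreCoeff i j * D^[j + 1] y) := by
      funext z
      rw [serreIter, ih, Derivative.serreDerivative, deriv_sum _ fun j _ => hm j,
        Finset.sum_apply, Finset.sum_apply, Finset.sum_apply, Finset.mul_sum,
        ← Finset.sum_sub_distrib]
      refine Finset.sum_congr rfl fun j _ => ?_
      rw [Derivative.normalizedDerivOfComplex_mul _ _ (mdiff_serreCoeff i j)
        (mdiff_iterate_deriv hy j), Function.iterate_succ_apply']
      simp only [Pi.add_apply, Pi.mul_apply, Derivative.serreDerivative]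
      ring
    rw [h1, Finset.sum_range_succ' _ (i + 1)]
    simp only [serreCoeff, add_mul, Finset.sum_add_distrib]
    rw [add_right_comm, ← Finset.sum_range_succ' (fun j =>
      Derivative.serreDerivative (2 * (i : ℂ)) (serreCoeff i j) * D^[j] y) (i + 1),
      Finset.sum_range_succ _ (i + 1), serreCoeff_of_lt (Nat.lt_succ_self i),
      serreDerivative_zero, zero_mul, add_zero]

theorem serreIter_eq_sum_fin {k : ℕ} {y : ℍ → ℂ} (hy : MDiff y) {i : ℕ} (hi : i < k) :
    serreIter i y = ∑ j : Fin k, serreCoeff i j * D^[j.val] y := by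
  rw [serreIter_eq_sum hy, ← Finset.sum_range fun j => serreCoeff i j * D^[j] y]
  refine Finset.sum_subset (Finset.range_mono (by omega)) fun j _ hj => ?_
  rw [serreCoeff_of_lt (by simpa using hj), zero_mul]

/-- The Wronskian may be computed with iterated Serre derivatives. -/
theorem det_serreIter {k : ℕ} {f : Fin k → ℍ → ℂ} (hf : ∀ j, MDiff (f j)) (z : ℍ) :
    (Matrix.of fun r c : Fin k => serreIter r (f c) z).det = wronskian 0 f z := by
  have h1 : (Matrix.of fun r c : Fin k => serreIter r (f c) z) =
      (Matrix.of fun r j : Fin k => serreCoeff r j z) *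
        Matrix.of fun r c : Fin k => D^[r.val] (f c) z := by
    ext r c
    simp [Matrix.mul_apply, serreIter_eq_sum_fin (hf c) r.2]
  have h2 : (Matrix.of fun r j : Fin k => serreCoeff r j z).det = 1 := by
    rw [Matrix.det_of_isLowerTriangular]
    · simp [serreCoeff_self]
    · intro i j hij
      simp only [Matrix.of_apply]
      rw [serreCoeff_of_lt (by exact_mod_cast hij)]
      rfl
  rw [h1, Matrix.det_mul, h2, one_mul, wronskian_zero_apply]

theorem exists_hasQExp_serreIter {r : ℚ} {p : PowerSeries ℚ} {f : ℍ → ℂ} (hf : HasQExp r p f)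
    (i : ℕ) : ∃ p, HasQExp r p (serreIter i f) := by
  induction i with
  | zero => exact ⟨p, hf⟩
  | succ i ih =>
    obtain ⟨u, hu⟩ := ih
    obtain ⟨e, he⟩ := exists_hasQExp_E2
    have hmul := he.mul hu
    rw [zero_add] at hmul
    have h := hu.deriv.sub (hmul.smul (2 * (i : ℚ) * 12⁻¹))
    have e : serreIter (i + 1) f = D (serreIter i f) -
        ((2 * (i : ℚ) * 12⁻¹ : ℚ) : ℂ) • (E2 * serreIter i f) := by
      funext z; simp [serreIter, Derivative.serreDerivative, mul_assoc]
    exact ⟨_, e ▸ h⟩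

/-! ### The action of `z ↦ -1/z` on Wronskians -/

theorem slash_S_eq_iff {f g : ℍ → ℂ} {n : ℤ} :
    f ∣[n] ModularGroup.S = g ↔ ∀ z : ℍ, f (ModularGroup.S • z) = (z : ℂ) ^ n * g z := by
  have h (z : ℍ) : (f ∣[n] ModularGroup.S) z = ((z : ℂ) ^ n)⁻¹ * f (ModularGroup.S • z) := by
    rw [SL_slash_apply, ModularGroup.denom_S, zpow_neg, mul_comm]
  rw [funext_iff]
  refine forall_congr' fun z => ?_
  have hz := zpow_ne_zero n z.ne_zero
  rw [h, inv_mul_eq_iff_eq_mul₀ hz]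

theorem S_smul_S_smul (z : ℍ) : ModularGroup.S • ModularGroup.S • z = z := by
  apply UpperHalfPlane.ext
  have := z.ne_zero
  rw [coe_S_smul, coe_S_smul]
  field_simp

theorem mdiff_serreIter {y : ℍ → ℂ} (hy : MDiff y) (n : ℕ) : MDiff (serreIter n y) := by
  induction n with
  | zero => exact hy
  | succ n ih => exact Derivative.serreDerivative_mdifferentiable _ ih

theorem serreIter_slash_S {y : ℍ → ℂ} (hy : MDiff y) (n : ℕ) :
    serreIter n y ∣[(2 * n : ℤ)] ModularGroup.S =
      serreIter n (y ∣[(0 : ℤ)] ModularGroup.S) := by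
  induction n with
  | zero => rfl
  | succ n ih =>
    have h := Derivative.serreDerivative_slash_equivariant (k := (2 * n : ℤ))
      (mdiff_serreIter hy n) (γ := ModularGroup.S)
    rw [ih] at h
    push_cast at h ⊢
    rw [show (2 * ((n : ℤ) + 1)) = 2 * n + 2 by ring]
    exact h

theorem serreIter_sum_smul {ι : Type*} [Fintype ι] {f : ι → ℍ → ℂ} (hf : ∀ i, MDiff (f i))
    (c : ι → ℂ) (n : ℕ) : serreIter n (∑ i, c i • f i) = ∑ i, c i • serreIter n (f i) := by
  rw [serreIter_eq_sum (mdiff_sum _ fun i _ => mdiff_smul _ (hf i))]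
  simp only [iterate_deriv_sum_smul hf, serreIter_eq_sum (hf _), Finset.smul_sum, Finset.mul_sum]
  rw [Finset.sum_comm]
  simp only [mul_smul_comm]

theorem serreIter_S_smul {k : ℕ} {f : Fin k → ℍ → ℂ} (hf : ∀ j, MDiff (f j))
    {s : Matrix (Fin k) (Fin k) ℂ}
    (hs : ∀ i z, f i (ModularGroup.S • z) = ∑ j, s i j * f j z) (n : ℕ) (i : Fin k) (z : ℍ) :
    serreIter n (f i) (ModularGroup.S • z) =
      (z : ℂ) ^ (2 * n) * ∑ j, s i j * serreIter n (f j) z := by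
  have h1 : f i ∣[(0 : ℤ)] ModularGroup.S = ∑ j, s i j • f j :=
    slash_S_eq_iff.mpr fun z => by
      rw [hs, zpow_zero, one_mul, Finset.sum_apply]
      rfl
  have h2 := slash_S_eq_iff.mp (serreIter_slash_S (hf i) n) z
  rw [h2, h1, serreIter_sum_smul hf]
  simp only [Finset.sum_apply, Pi.smul_apply, smul_eq_mul]
  norm_cast

/-- The matrix of iterated Serre derivatives of the `f c`, with rows indexed by the order. -/
def serreMatrix {k : ℕ} (f : Fin k → ℍ → ℂ) (z : ℍ) : Matrix (Fin k) (Fin k) ℂ :=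
  Matrix.of fun r c => serreIter r (f c) z

theorem serreMatrix_S_smul {k : ℕ} {f : Fin k → ℍ → ℂ} (hf : ∀ j, MDiff (f j))
    {s : Matrix (Fin k) (Fin k) ℂ}
    (hs : ∀ i z, f i (ModularGroup.S • z) = ∑ j, s i j * f j z) (z : ℍ) :
    serreMatrix f (ModularGroup.S • z) =
      Matrix.diagonal (fun r : Fin k => (z : ℂ) ^ (2 * r.val)) * (serreMatrix f z * s.transpose) := by
  ext r c
  rw [Matrix.diagonal_mul]
  simp only [serreMatrix, Matrix.of_apply, Matrix.mul_apply, Matrix.transpose_apply,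
    serreIter_S_smul hf hs]
  simp only [mul_comm (s _ _)]

theorem wronskian_S_smul {k : ℕ} {f : Fin k → ℍ → ℂ} (hf : ∀ j, MDiff (f j))
    {s : Matrix (Fin k) (Fin k) ℂ}
    (hs : ∀ i z, f i (ModularGroup.S • z) = ∑ j, s i j * f j z) (z : ℍ) :
    wronskian 0 f (ModularGroup.S • z) =
      (z : ℂ) ^ (2 * ∑ r : Fin k, r.val) * s.det * wronskian 0 f z := by
  have h := congrArg Matrix.det (serreMatrix_S_smul hf hs z)
  rw [Matrix.det_mul, Matrix.det_mul, Matrix.det_diagonal, Matrix.det_transpose,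
    Finset.prod_pow_eq_pow_sum, ← Finset.mul_sum] at h
  simp only [serreMatrix, det_serreIter hf] at h
  rw [h]
  ring

/-- Two applications of `z ↦ -1/z` to the Wronskian, whose weight is even, give back the
Wronskian. -/
theorem det_sq_eq_one {k : ℕ} {f : Fin k → ℍ → ℂ} (hf : ∀ j, MDiff (f j))
    {s : Matrix (Fin k) (Fin k) ℂ}
    (hs : ∀ i z, f i (ModularGroup.S • z) = ∑ j, s i j * f j z) (hw : wronskian 0 f ≠ 0) :
    s.det ^ 2 = 1 := by
  obtain ⟨z, hz⟩ := Function.ne_iff.mp hw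
  have h := wronskian_S_smul hf hs (ModularGroup.S • z)
  rw [S_smul_S_smul, wronskian_S_smul hf hs z, coe_S_smul] at h
  have hz0 := z.ne_zero
  rw [pow_mul, pow_mul, div_pow, neg_one_sq, div_pow, one_pow] at h
  have h2 : ((z : ℂ) ^ 2) ^ (∑ r : Fin k, r.val) ≠ 0 := by positivity
  field_simp at h
  exact mul_left_cancel₀ hz (h.symm.trans (mul_one _).symm)

/-! ### Monic equations with modular coefficients -/

theorem HasQExp.iterate_deriv {r : ℚ} {p : PowerSeries ℚ} {f : ℍ → ℂ} (hf : HasQExp r p f) (m : ℕ) :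
    HasQExp r (PowerSeries.mk fun n : ℕ => (r + n) ^ m * p.coeff n) (D^[m] f) := by
  induction m with
  | zero =>
    convert hf
    · ext n
      simp
    · rfl
  | succ m ih =>
    rw [Function.iterate_succ_apply']
    convert ih.deriv using 2
    funext n
    rw [PowerSeries.coeff_mk]
    ring

/-- The constant term of the expansion of a Wronskian of `q`-expansions with leading coefficients `1`
is a determinant in the exponents. -/
theorem exists_hasQExp_wronskian {k : ℕ} {f : Fin k → ℍ → ℂ} {r : Fin k → ℚ}
    (hf : ∀ j, ∃ p : PowerSeries ℚ, p.constantCoeff = 1 ∧ HasQExp (r j) p (f j)) (m : ℕ) :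
    ∃ u : PowerSeries ℚ, u.constantCoeff = (Matrix.of fun i j : Fin k => r j ^ (i.val + m)).det ∧
      HasQExp (∑ j, r j) u (wronskian m f) := by
  choose p hp1 hp using hf
  refine ⟨_, ?_, HasQExp.det (p := Matrix.of fun i j => PowerSeries.mk fun n : ℕ =>
    (r j + n) ^ (i.val + m) * (p j).coeff n) fun i j => (hp j).iterate_deriv (i.val + m)⟩
  rw [RingHom.map_det]
  congr 1
  ext i j
  rw [RingHom.mapMatrix_apply, Matrix.map_apply, Matrix.of_apply, ← PowerSeries.coeff_zero_eq_constantCoeff_apply,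
    PowerSeries.coeff_mk, PowerSeries.coeff_zero_eq_constantCoeff_apply, hp1]
  simp

/-- For distinct exponents the leading coefficient is a nonzero Vandermonde determinant. -/
theorem exists_hasQExp_wronskian_zero {k : ℕ} {f : Fin k → ℍ → ℂ} {r : Fin k → ℚ}
    (hf : ∀ j, ∃ p : PowerSeries ℚ, p.constantCoeff = 1 ∧ HasQExp (r j) p (f j))
    (hr : Function.Injective r) :
    ∃ u : PowerSeries ℚ, u.constantCoeff ≠ 0 ∧ HasQExp (∑ j, r j) u (wronskian 0 f) := by
  obtain ⟨u, hu, h⟩ := exists_hasQExp_wronskian hf 0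
  refine ⟨u, ?_, h⟩
  rw [hu, ← Matrix.det_transpose]
  exact Matrix.det_vandermonde_ne_zero_iff.mpr hr

theorem HasQExp.ne_zero {r : ℚ} {u : PowerSeries ℚ} {f : ℍ → ℂ} (hf : HasQExp r u f)
    (hu : u.constantCoeff ≠ 0) : f ≠ 0 := by
  rintro rfl
  obtain ⟨F, hF, h⟩ := hasQExp_iff_exists.mp hf
  -- at `q = 0`, which no point of the upper half-plane attains, `F` vanishes by continuity
  have hF0 : DiscSum 0 F := by
    have hc : ContinuousAt F 0 :=
      (hF.differentiableOn.differentiableAt (Metric.ball_mem_nhds _ one_pos)).continuousAt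
    have hq (q : ℂ) (hq : ‖q‖ < 1) (h0 : q ≠ 0) : F q = 0 := by
      obtain ⟨z, rfl⟩ := exists_qPow_one_eq hq h0
      exact (mul_eq_zero.mp (h z).symm).resolve_left (qPow_ne_zero r z)
    have h0 : F 0 = 0 := by
      have h1 : Tendsto F (𝓝[≠] 0) (𝓝 (F 0)) := hc.tendsto.mono_left nhdsWithin_le_nhds
      refine tendsto_nhds_unique h1 (tendsto_const_nhds.congr' ?_)
      filter_upwards [self_mem_nhdsWithin,
        nhdsWithin_le_nhds (Metric.ball_mem_nhds (0 : ℂ) one_pos)] with q h2 h3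
      exact (hq q (by simpa using h3) h2).symm
    intro q hq1
    have : F q = 0 := by
      rcases eq_or_ne q 0 with rfl | h1
      · exact h0
      · exact hq q hq1 h1
    simp [this]
  have h1 := congrArg (PowerSeries.coeff 0) (hF.eq_of_eqOn hF0)
  rw [PowerSeries.coeff_map, map_zero] at h1
  exact hu (by simpa using h1)

/-- The `12`-th power of the Wronskian is a nonzero multiple of a power of the discriminant. -/
theorem wronskian_zero_ne_zero {k : ℕ} {f : Fin k → ℍ → ℂ} {r : Fin k → ℚ}
    (hf : ∀ j, ∃ p : PowerSeries ℚ, p.constantCoeff = 1 ∧ HasQExp (r j) p (f j))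
    (hr : Function.Injective r) (hsum : 12 * ∑ j, r j = 2 * ∑ j : Fin k, (j.val : ℚ))
    {s : Matrix (Fin k) (Fin k) ℂ}
    (hs : ∀ i z, f i (ModularGroup.S • z) = ∑ j, s i j * f j z) (z : ℍ) :
    wronskian 0 f z ≠ 0 := by
  have hm (j : Fin k) : MDiff (f j) := (hf j).choose_spec.2.mdiff
  obtain ⟨u, hu, hw⟩ := exists_hasQExp_wronskian_zero hf hr
  have hw0 := hw.ne_zero hu
  have hdet := det_sq_eq_one hm hs hw0
  obtain ⟨δ, hδ1, hδ⟩ := exists_hasQExp_discriminant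
  set N := ∑ j : Fin k, j.val with hN
  have hq := (hw.pow 12).div (hδ.pow (2 * N)) (by simp [hδ1])
    (fun z => pow_ne_zero _ (discriminant_ne_zero z))
  have h0 : ((12 : ℕ) : ℚ) * ∑ j, r j - ((2 * N : ℕ) : ℚ) * 1 = 0 := by
    push_cast [hN]
    linear_combination hsum
  rw [h0] at hq
  have hΔ := slash_S_eq_iff.mp discriminant_S_invariant
  obtain ⟨G, hG⟩ := hq.exists_modularForm (k := 0) (slash_S_eq_iff.mpr fun z => by
    have hz := z.ne_zero
    have hΔz := discriminant_ne_zero z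
    have h12 : s.det ^ 12 = 1 := by rw [show 12 = 2 * 6 by rfl, pow_mul, hdet, one_pow]
    simp only [Pi.div_apply, Pi.pow_apply, hΔ, wronskian_S_smul hm hs, mul_pow, h12, zpow_zero,
      one_mul, mul_one]
    rw [← hN, ← pow_mul, mul_comm (2 * N) 12, show ((z : ℂ) ^ (12 : ℤ)) = (z : ℂ) ^ 12 from rfl,
      ← pow_mul]
    exact mul_div_mul_left _ _ (pow_ne_zero _ hz))
  obtain ⟨c, hc⟩ := ModularFormClass.levelOne_weight_zero_const G
  have key (z : ℍ) : wronskian 0 f z ^ 12 = c * discriminant z ^ (2 * N) := by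
    have h1 := congrFun (hG.symm.trans hc) z
    rwa [Pi.div_apply, Pi.pow_apply, Pi.pow_apply, Function.const_apply,
      div_eq_iff (pow_ne_zero _ (discriminant_ne_zero z))] at h1
  have hc0 : c ≠ 0 := by
    rintro rfl
    refine hw0 (funext fun z => ?_)
    have := key z
    rw [zero_mul] at this
    exact pow_eq_zero_iff (by norm_num) |>.mp this
  intro h
  have := key z
  rw [h, zero_pow (by norm_num)] at this
  exact mul_ne_zero hc0 (pow_ne_zero _ (discriminant_ne_zero z)) this.symm

/-- The modular form of weight `2k - 2i` that multiplies `Θ^i y` in the monic equation satisfied by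
the `f c`, given by Cramer's rule. -/
def cramerCoeff {k : ℕ} (f : Fin k → ℍ → ℂ) (i : Fin k) : ℍ → ℂ :=
  (fun z => ((serreMatrix f z).updateRow i fun c => -serreIter k (f c) z).det) / wronskian 0 f

theorem sum_cramerCoeff_mul {k : ℕ} {f : Fin k → ℍ → ℂ} (hf : ∀ j, MDiff (f j)) {z : ℍ}
    (hw : wronskian 0 f z ≠ 0) (c : Fin k) :
    ∑ i, cramerCoeff f i z * serreIter i (f c) z = -serreIter k (f c) z := by
  have h := congrFun (Matrix.mulVec_cramer (serreMatrix f z).transpose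
    fun c => -serreIter k (f c) z) c
  have hd : (serreMatrix f z).det = wronskian 0 f z := det_serreIter hf z
  simp only [Matrix.mulVec, dotProduct, Matrix.cramer_transpose_apply, Matrix.transpose_apply,
    Matrix.det_transpose, Pi.smul_apply, smul_eq_mul, hd] at h
  rw [← mul_right_inj' hw, ← h, Finset.mul_sum]
  refine Finset.sum_congr rfl fun i _ => ?_
  simp only [cramerCoeff, Pi.div_apply]
  rw [← mul_assoc, mul_div_cancel₀ _ hw, mul_comm]
  rfl

theorem exists_hasQExp_cramerCoeff {k : ℕ} {f : Fin k → ℍ → ℂ} {r : Fin k → ℚ}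
    (hf : ∀ j, ∃ p : PowerSeries ℚ, p.constantCoeff = 1 ∧ HasQExp (r j) p (f j))
    (hr : Function.Injective r) (hw : ∀ z, wronskian 0 f z ≠ 0) (i : Fin k) :
    ∃ p, HasQExp 0 p (cramerCoeff f i) := by
  obtain ⟨u, hu, hwq⟩ := exists_hasQExp_wronskian_zero hf hr
  have h (a c : Fin k) : ∃ p, HasQExp (r c) p
      (if a = i then -serreIter k (f c) else serreIter a (f c)) := by
    obtain ⟨p, -, hp⟩ := hf c
    split_ifs
    · obtain ⟨q, hq⟩ := exists_hasQExp_serreIter hp k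
      exact ⟨_, by simpa using HasQExp.zero.sub hq⟩
    · exact exists_hasQExp_serreIter hp a
  choose p hp using h
  have hdet := (HasQExp.det hp).div hwq hu hw
  rw [sub_self] at hdet
  have e (z : ℍ) : ((serreMatrix f z).updateRow i fun c => -serreIter k (f c) z) =
      Matrix.of fun a c => (if a = i then -serreIter k (f c) else serreIter a (f c)) z := by
    ext a c
    rw [Matrix.updateRow_apply]
    split_ifs with h <;> simp [serreMatrix, h]
  simp only [← e] at hdet
  exact ⟨_, hdet⟩

theorem cramerCoeff_slash_S {k : ℕ} {f : Fin k → ℍ → ℂ} (hf : ∀ j, MDiff (f j))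
    (hw : ∀ z, wronskian 0 f z ≠ 0) {s : Matrix (Fin k) (Fin k) ℂ}
    (hs : ∀ i z, f i (ModularGroup.S • z) = ∑ j, s i j * f j z) (i : Fin k) :
    cramerCoeff f i ∣[(2 * k - 2 * i.val : ℤ)] ModularGroup.S = cramerCoeff f i := by
  refine slash_S_eq_iff.mpr fun z => ?_
  have hz := z.ne_zero
  have hs0 : s.det ≠ 0 := by
    intro h
    have := det_sq_eq_one hf hs (Function.ne_iff.mpr ⟨z, hw z⟩)
    simp [h] at this
  set v : Fin k → ℂ := fun i => cramerCoeff f i (ModularGroup.S • z) * (z : ℂ) ^ (2 * i.val) -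
    (z : ℂ) ^ (2 * k) * cramerCoeff f i z with hv
  -- both sides of the claim solve the linear system that determines the coefficients
  have h1 : Matrix.vecMul v (serreMatrix f z * s.transpose) = 0 := by
    funext c
    have h2 := sum_cramerCoeff_mul hf (hw (ModularGroup.S • z)) c
    simp only [serreIter_S_smul hf hs] at h2
    have h3 : ∑ i : Fin k, cramerCoeff f i z * ∑ j, s c j * serreIter i (f j) z =
        -∑ j, s c j * serreIter k (f j) z := by
      simp only [Finset.mul_sum, ← Finset.sum_neg_distrib]
      rw [Finset.sum_comm]
      refine Finset.sum_congr rfl fun j _ => ?_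
      rw [← mul_neg, ← sum_cramerCoeff_mul hf (hw z) j, Finset.mul_sum]
      simp only [mul_left_comm]
    simp only [Matrix.vecMul, dotProduct, Matrix.mul_apply, Matrix.transpose_apply, serreMatrix,
      Matrix.of_apply, Pi.zero_apply, hv, sub_mul, Finset.sum_sub_distrib]
    simp only [mul_comm _ (s c _), mul_assoc, ← Finset.mul_sum]
    rw [h2, h3]
    ring
  have h2 : v = 0 := Matrix.eq_zero_of_vecMul_eq_zero (by
    rw [Matrix.det_mul, Matrix.det_transpose]
    exact mul_ne_zero ((det_serreIter hf z).trans_ne (hw z)) hs0) h1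
  have h3 := congrFun h2 i
  simp only [hv, Pi.zero_apply] at h3
  have hz2 : (z : ℂ) ^ (2 * i.val) ≠ 0 := pow_ne_zero _ hz
  rw [zpow_sub₀ hz, ← mul_left_inj' hz2, sub_eq_zero.mp h3]
  norm_cast
  field_simp

/-- The coefficient of `D^j y` in the monic equation satisfied by the `f c`. -/
def monicCoeff {k : ℕ} (f : Fin k → ℍ → ℂ) (j : Fin k) : ℍ → ℂ :=
  serreCoeff k j + ∑ i, cramerCoeff f i * serreCoeff i j

theorem monicOp_monicCoeff {k : ℕ} (f : Fin k → ℍ → ℂ) {y : ℍ → ℂ} (hy : MDiff y) :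
    monicOp (monicCoeff f) y = serreIter k y + ∑ i : Fin k, cramerCoeff f i * serreIter i y := by
  rw [serreIter_eq_sum hy, Finset.sum_range_succ, serreCoeff_self, one_mul,
    Finset.sum_range fun j => serreCoeff k j * D^[j] y]
  simp only [monicOp, monicCoeff, add_mul, Finset.sum_add_distrib, Finset.sum_mul,
    serreIter_eq_sum_fin hy (Fin.is_lt _), Finset.mul_sum, mul_assoc]
  rw [Finset.sum_comm]
  ring

theorem monicOp_monicCoeff_eq_zero {k : ℕ} {f : Fin k → ℍ → ℂ} (hf : ∀ j, MDiff (f j))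
    (hw : ∀ z, wronskian 0 f z ≠ 0) (j : Fin k) : monicOp (monicCoeff f) (f j) = 0 := by
  rw [monicOp_monicCoeff f (hf j)]
  funext z
  have := sum_cramerCoeff_mul hf (hw z) j
  simp [this]

theorem monicCoeff_zero {k : ℕ} (hk : 0 < k) (f : Fin k → ℍ → ℂ) :
    monicCoeff f ⟨0, hk⟩ = cramerCoeff f ⟨0, hk⟩ := by
  obtain ⟨n, rfl⟩ := Nat.exists_eq_succ_of_ne_zero hk.ne'
  simp only [monicCoeff, Nat.succ_eq_add_one, serreCoeff_succ_zero, zero_add]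
  rw [Fin.sum_univ_succ]
  simp [serreCoeff_succ_zero, serreCoeff]

theorem monicCoeff_mem {k : ℕ} {f : Fin k → ℍ → ℂ}
    (hf : ∀ i, cramerCoeff f i ∈ quasiModularRing) (j : Fin k) :
    monicCoeff f j ∈ quasiModularRing :=
  add_mem (serreCoeff_mem _ _) (sum_mem fun i _ => mul_mem (hf i) (serreCoeff_mem _ _))

/-! ### Normalization and the characters -/

theorem HasLeadingCoeff.inv_smul {f : ℍ → ℂ} {c : ℂ} (h : HasLeadingCoeff f c) :
    HasLeadingCoeff (c⁻¹ • f) 1 := by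
  obtain ⟨hc, r, a, ha, hs⟩ := h
  refine ⟨one_ne_zero, r, fun n => c⁻¹ * a n, by simp [ha, hc], fun z => ?_⟩
  simpa only [mul_assoc, Pi.smul_apply, smul_eq_mul] using (hs z).mul_left c⁻¹

theorem exists_normalize_eq {r : ℚ} {p : PowerSeries ℚ} {f : ℍ → ℂ} (hf : HasQExp r p f)
    (h0 : f ≠ 0) :
    ∃ c : ℂ, c ≠ 0 ∧ normalize f = c • f ∧ HasLeadingCoeff (normalize f) 1 := by
  have h := hf.exists_hasLeadingCoeff h0
  refine ⟨h.choose⁻¹, inv_ne_zero h.choose_spec.1, ?_, ?_⟩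
  · rw [normalize, dif_pos h]
  · rw [normalize, dif_pos h]
    exact h.choose_spec.inv_smul

theorem normalize_zero : normalize 0 = 0 := by
  rw [normalize]
  split_ifs <;> simp

theorem exists_hasQExp_characters (k : ℕ) (j : Fin k) : ∃ p : PowerSeries ℚ,
    p.constantCoeff = 1 ∧ HasQExp (thetaExponent k (j.val + 1) - 1 / 24) p (characters k j) :=
  exists_hasQExp_character (by omega) (by omega)

theorem thetaExponent_injective (k : ℕ) :
    Function.Injective fun j : Fin k => thetaExponent k (j.val + 1) - 1 / 24 := by
  intro a b h
  have ha : ((a.val : ℚ) + 1) ≤ k := by exact_mod_cast a.2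
  have hb : ((b.val : ℚ) + 1) ≤ k := by exact_mod_cast b.2
  have h0 : (8 * (2 * (k : ℚ) + 1)) ≠ 0 := by positivity
  simp only [thetaExponent, sub_left_inj, div_left_inj' h0] at h
  push_cast at h
  rcases sq_eq_sq_iff_eq_or_eq_neg.mp h with h | h
  · exact Fin.ext (by exact_mod_cast (by linarith : (a.val : ℚ) = b.val))
  · linarith

theorem sum_thetaExponent (k : ℕ) :
    12 * ∑ j : Fin k, (thetaExponent k (j.val + 1) - 1 / 24) = 2 * ∑ j : Fin k, (j.val : ℚ) := by
  have h (n : ℕ) : ∑ j ∈ Finset.range n, (2 * (k : ℚ) + 1 - 2 * ((j + 1 : ℕ) : ℚ)) ^ 2 =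
      (n : ℚ) * (2 * k + 1) ^ 2 - 2 * (2 * k + 1) * (n * (n + 1)) +
        2 / 3 * (n * (n + 1) * (2 * n + 1)) := by
    induction n with
    | zero => simp
    | succ n ih => rw [Finset.sum_range_succ, ih]; push_cast; ring
  have h2 (n : ℕ) : ∑ j ∈ Finset.range n, (j : ℚ) = n * (n - 1) / 2 := by
    induction n with
    | zero => simp
    | succ n ih => rw [Finset.sum_range_succ, ih]; push_cast; ring
  rw [← Finset.sum_range fun j => thetaExponent k (j + 1) - 1 / 24,
    ← Finset.sum_range fun j => (j : ℚ), h2]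
  simp only [thetaExponent, Finset.sum_sub_distrib, ← Finset.sum_div, h]
  have h0 : (2 * (k : ℚ) + 1) ≠ 0 := by positivity
  simp
  field_simp
  ring

end AndrewsGordon

end

open AndrewsGordon

theorem theorem1p2 (k : ℕ) (hk : 2 ≤ k) :
    -- `𝒲_k` and `𝒲'_k` are well normalized, and `𝒲_k` has no zeros
    (AndrewsGordon.HasLeadingCoeff (AndrewsGordon.W k) 1 ∧
      (∀ z, AndrewsGordon.W k z ≠ 0) ∧
      (AndrewsGordon.wronskian 1 (AndrewsGordon.characters k) = 0 ∨
        AndrewsGordon.HasLeadingCoeff (AndrewsGordon.W' k) 1)) ∧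
    -- `𝓕_k` is a holomorphic modular form of weight `2k` on `SL₂(ℤ)`
    (∃ f : ModularForm 𝒮ℒ (2 * (k : ℤ)), ⇑f = AndrewsGordon.F k) ∧
    -- `𝓕_k` is, up to a nonzero constant, the coefficient `P₀` of the unique monic equation of order
    -- `k` satisfied by the characters, which is modular and has them as a fundamental system
    (∃ P : Fin k → UpperHalfPlane → ℂ,
      AndrewsGordon.IsModularOp P ∧
      AndrewsGordon.IsFundamentalSystem P (AndrewsGordon.characters k) ∧
      (∀ P' : Fin k → UpperHalfPlane → ℂ,
        (∀ j, AndrewsGordon.monicOp P' (AndrewsGordon.characters k j) = 0) → P' = P) ∧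
      ∃ c : ℂ, c ≠ 0 ∧ P ⟨0, by omega⟩ = c • AndrewsGordon.F k) := by
  have hk0 : 0 < k := by omega
  obtain ⟨s, hs⟩ := exists_characters_S_smul k
  have hq := exists_hasQExp_characters k
  have hinj := thetaExponent_injective k
  have hm (j : Fin k) : MDiff (characters k j) := (hq j).choose_spec.2.mdiff
  have hw : ∀ z, wronskian 0 (characters k) z ≠ 0 :=
    wronskian_zero_ne_zero hq hinj (sum_thetaExponent k) hs
  have hP := monicOp_monicCoeff_eq_zero hm hw
  have hP0 := monicCoeff_zero hk0 (characters k)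
  have hSQ := cramerCoeff_slash_S hm hw hs
  choose u hu using exists_hasQExp_cramerCoeff hq hinj hw
  choose Q hQ using fun i => (hu i).exists_modularForm (hSQ i)
  obtain ⟨v, -, hv⟩ := exists_hasQExp_wronskian hq 0
  obtain ⟨v', -, hv'⟩ := exists_hasQExp_wronskian hq 1
  obtain ⟨c, hc0, hc, hW⟩ := exists_normalize_eq hv (Function.ne_iff.mpr ⟨UpperHalfPlane.I, hw _⟩)
  have hWc (z : UpperHalfPlane) : W k z = c * wronskian 0 (characters k) z := congrFun hc z
  have hone := wronskian_one hk0 hP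
  -- the two cases for the second determinant give the proportionality of `𝓕_k` and `P₀`
  have hF : (wronskian 1 (characters k) = 0 ∨ HasLeadingCoeff (W' k) 1) ∧
      ∃ d : ℂ, d ≠ 0 ∧ monicCoeff (characters k) ⟨0, hk0⟩ = d • F k := by
    by_cases h1 : wronskian 1 (characters k) = 0
    · refine ⟨.inl h1, 1, one_ne_zero, ?_⟩
      funext z
      have h2 := congrFun hone z
      rw [h1] at h2
      simp only [Pi.zero_apply, Pi.smul_apply, Pi.mul_apply, smul_eq_mul] at h2
      have h3 : monicCoeff (characters k) ⟨0, hk0⟩ z = 0 := by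
        simpa [hw z] using h2.symm
      simp [h3, F, W', h1, normalize_zero]
    · obtain ⟨c', hc0', hc', hW'⟩ := exists_normalize_eq hv' h1
      refine ⟨.inr hW', c * c'⁻¹ * (-1) ^ k,
        mul_ne_zero (mul_ne_zero hc0 (inv_ne_zero hc0')) (by simp), ?_⟩
      funext z
      have hW'c : W' k z = c' * wronskian 1 (characters k) z := congrFun hc' z
      have h2 := hw z
      simp only [Pi.smul_apply, smul_eq_mul, F, hW'c, hWc, hone, Pi.mul_apply]
      have h3 : ((-1 : ℂ) ^ k) * (-1) ^ k = 1 := by rw [← mul_pow]; simp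
      field_simp
      linear_combination (-(monicCoeff (characters k) ⟨0, hk0⟩ z)) * h3
  obtain ⟨hF1, d, hd0, hd⟩ := hF
  refine ⟨⟨hW, fun z => ?_, hF1⟩, ?_, monicCoeff (characters k), ⟨fun i => ?_, Q, fun y hy => ?_⟩,
    isFundamentalSystem_of_wronskian_ne_zero hm hw hP, fun P' hP' => eq_of_monicOp_eq_zero hw hP hP',
    d, hd0, hd⟩
  · rw [hWc]
    exact mul_ne_zero hc0 (hw z)
  · refine ⟨d⁻¹ • ModularForm.mcast (by simp) (Q ⟨0, hk0⟩), ?_⟩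
    rw [← inv_smul_smul₀ hd0 (F k), ← hd, hP0, ← hQ]
    rfl
  · exact monicCoeff_mem (fun i => (hu i).mem_quasiModularRing (hSQ i)) i
  · simp only [hQ]
    exact monicOp_monicCoeff _ hy
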